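/- Let $\mathbb{D}$ be the open unit disc. A *weight* is a measurable function $w:\mathbb{D}\to(0,\infty)$. For an arc $I$ of the unit circle, let $|I|\in(0,1]$ be its normalized length (the whole circle is an arc of length $1$), let $$S(I)=\Big\{z\in\mathbb{D}\setminus\{0\} : \tfrac{z}{|z|}\in I,\ 1-|z|<|I|\Big\}$$ be its Carleson square, and let $\langle f\rangle_{S(I)}\in[0,\infty]$ be the average of $f\ge 0$ over $S(I)$ with respect to area measure. For $1<p<\infty$, $w\in B_p$ means that $$\sup_I\ \langle w\rangle_{S(I)}\,\big\langle w^{-1/(p-1)}\big\rangle_{S(I)}^{\,p-1}<\infty ,$$ and $w\in B_1$ means that there is a constant $C<\infty$ such that $\sup_{I:\,z\in S(I)}\langle w\rangle_{S(I)}\le C\,w(z)$ for almost every $z\in\mathbb{D}$. A weight $w$ is of *bounded hyperbolic oscillation* if there is a constant $L>0$ such that $$|\log w(z)-\log w(\zeta)|\le L\,\big(1+\beta(z,\zeta)\big)\quad\text{for almost every } (z,\zeta)\in\mathbb{D}\times\mathbb{D},$$ where $\beta(z,\zeta)=\frac12\log\frac{1+\rho(z,\zeta)}{1-\rho(z,\zeta)}$,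 $\rho(z,\zeta)=\left|\frac{\zeta-z}{1-\overline{\zeta}z}\right|$, is the hyperbolic metric of $\mathbb{D}$. **Corollary.** Let $1<p<\infty$ and let $w$ be a weight on $\mathbb{D}$ of bounded hyperbolic oscillation. Then $w\in B_p$ if and only if there exist weights $w_1,w_2\in B_1$, each of bounded hyperbolic oscillation, such that $w=w_1w_2^{1-p}$ on $\mathbb{D}$. -/

import Mathlib

open MeasureTheory Set
open scoped ENNReal NNReal

noncomputable section

namespace BekolleBonami

/-- The open unit disc, as a subset of the complex plane. -/
def disc : Set ℂ := Metric.ball 0 1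

/-- The point of the unit circle with normalized angle `t`, that is, `exp (2 * π * i * t)`. -/
def circlePoint (t : ℝ) : ℂ := Complex.exp (2 * (Real.pi : ℂ) * Complex.I * (t : ℂ))

/-- `I` is a (non-degenerate) arc of the unit circle, of normalized length `ℓ`. Each of the two
endpoints may or may not belong to `I`; the whole circle is an arc of length `1`. -/
def IsArc (I : Set ℂ) (ℓ : ℝ) : Prop :=
  0 < ℓ ∧ ℓ ≤ 1 ∧
    ∃ a : ℝ, circlePoint '' Ioo a (a + ℓ) ⊆ I ∧ I ⊆ circlePoint '' Icc a (a + ℓ)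

/-- The Carleson square over an arc `I` of normalized length `ℓ`. -/
def carlesonSquare (I : Set ℂ) (ℓ : ℝ) : Set ℂ :=
  {z : ℂ | z ∈ disc ∧ z ≠ 0 ∧ z / (‖z‖ : ℂ) ∈ I ∧ 1 - ‖z‖ < ℓ}

/-- A weight on the disc: a function that is measurable and positive on the disc.
Its values outside the disc play no role. -/
structure IsWeight (w : ℂ → ℝ) : Prop where
  measurable : Measurable (disc.domRestrict w)
  pos : ∀ z ∈ disc, 0 < w z

/-- The average of `w` over the Carleson square of `I`, with values in `[0, ∞]`. (Averages do not
depend on how the area measure is normalized.) -/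
def squareAverage (w : ℂ → ℝ) (I : Set ℂ) (ℓ : ℝ) : ℝ≥0∞ :=
  laverage (volume.restrict (carlesonSquare I ℓ)) (fun z => ENNReal.ofReal (w z))

/-- The Békollé--Bonami characteristic `[w]_{B_p}`, for `p > 1`. -/
def bpConstant (p : ℝ) (w : ℂ → ℝ) : ℝ≥0∞ :=
  ⨆ (I : Set ℂ) (ℓ : ℝ) (_ : IsArc I ℓ),
    squareAverage w I ℓ * squareAverage (fun z => w z ^ (-(1 / (p - 1)))) I ℓ ^ (p - 1)

/-- The class `B_p`, for `p > 1`. -/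
def MemBp (p : ℝ) (w : ℂ → ℝ) : Prop := bpConstant p w < ∞

/-- The maximal function associated with Carleson squares, for a positive weight `w`. -/
def maximalFunction (w : ℂ → ℝ) (z : ℂ) : ℝ≥0∞ :=
  ⨆ (I : Set ℂ) (ℓ : ℝ) (_ : IsArc I ℓ) (_ : z ∈ carlesonSquare I ℓ), squareAverage w I ℓ

/-- The class `B_1`. -/
def MemB1 (w : ℂ → ℝ) : Prop :=
  ∃ C : ℝ≥0, ∀ᵐ z ∂(volume.restrict disc),
    maximalFunction w z ≤ (C : ℝ≥0∞) * ENNReal.ofReal (w z)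

/-- The pseudo-hyperbolic distance on the disc. -/
def pseudoHyperbolicDist (z ζ : ℂ) : ℝ :=
  ‖(ζ - z) / (1 - (starRingEnd ℂ) ζ * z)‖

/-- The hyperbolic metric on the disc. -/
def hyperbolicDist (z ζ : ℂ) : ℝ :=
  1 / 2 * Real.log ((1 + pseudoHyperbolicDist z ζ) / (1 - pseudoHyperbolicDist z ζ))

/-- Bounded hyperbolic oscillation: `log w` is quasi-Lipschitz for the hyperbolic metric, at almost
every pair of points of the disc. -/
def BoundedHyperbolicOscillation (w : ℂ → ℝ) : Prop :=
  ∃ L : ℝ, 0 < L ∧ ∀ᵐ q ∂((volume.restrict disc).prod (volume.restrict disc)),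
    |Real.log (w q.1) - Real.log (w q.2)| ≤ L * (1 + hyperbolicDist q.1 q.2)

end BekolleBonami

end

/-! Easy direction: on a Carleson square a `B_1` weight is bounded below, almost everywhere, by a
multiple of its average. Inserting this into the negative powers of `w₂` and `w₁` makes all averages
cancel in the `B_p` product.

Hard direction: Jones factorization followed by smoothing. Carleson squares are comparable with
discs centred on the unit circle, so one works with `ballMaximal`, written M below, and with p = s +
1. Only these discs are tested, and on them a `B_p` weight W is doubling. Vitali covering makes the
weighted maximal functions bounded, and Lerner's pointwise estimate composes two of them to bound M
on L^p(W). The dual weight W^(-1/s) satisfies the same kind of condition, so the operator T u =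
max(M u, (W⁻¹ M(W u^s))^(1/s)) is bounded on L^p(W). The increasing iteration of max(1, ε T)
converges to some u with ε M u ≤ u and ε^s M(W u^s) ≤ W u^s (`IsBallBp.exists_factorization`).
Taking suprema instead of sums needs only monotonicity of T, so no case distinction on p arises.

This u may be irregular. It is replaced by v = M u, and the factors are w v^s and v. A finite
positive maximal function automatically has bounded hyperbolic oscillation
(`ballMaximal_le_mul_ballMaximal`). From M u ≤ C u follows M v ≤ C v. The oscillation hypothesis on
w gives M(w u^s) ≤ C' w v^s (`ballMaximal_smoothing_le`), which is what the other factor needs. -/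

noncomputable section

namespace BekolleBonami

/-! ### Maximal functions over balls on which the measure is doubling. -/

section RestrictedMaximal

variable {α : Type*} [PseudoMetricSpace α] [MeasurableSpace α]

/-- The maximal function with respect to `μ`, over balls with centre in `Z` and radius at
most `R`. -/
def restrictedMaximal (μ : Measure α) (Z : Set α) (R : ℝ) (f : α → ℝ≥0∞) (x : α) : ℝ≥0∞ :=
  ⨆ (c : α) (r : ℝ) (_ : c ∈ Z ∧ 0 < r ∧ r ≤ R ∧ x ∈ Metric.ball c r),
    (∫⁻ y in Metric.ball c r, f y ∂μ) / μ (Metric.ball c r)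

variable {μ : Measure α} {Z : Set α} {R : ℝ}

theorem lt_restrictedMaximal_iff {f : α → ℝ≥0∞} {x : α} {t : ℝ≥0∞} :
    t < restrictedMaximal μ Z R f x ↔
      ∃ c ∈ Z, ∃ r, 0 < r ∧ r ≤ R ∧ x ∈ Metric.ball c r ∧
        t < (∫⁻ y in Metric.ball c r, f y ∂μ) / μ (Metric.ball c r) := by
  simp only [restrictedMaximal, lt_iSup_iff]
  constructor
  · rintro ⟨c, r, ⟨h1, h2, h3, h4⟩, h5⟩
    exact ⟨c, h1, r, h2, h3, h4, h5⟩
  · rintro ⟨c, h1, r, h2, h3, h4, h5⟩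
    exact ⟨c, r, ⟨h1, h2, h3, h4⟩, h5⟩

theorem average_le_restrictedMaximal (f : α → ℝ≥0∞) {c x : α} {r : ℝ} (hc : c ∈ Z) (hr : 0 < r)
    (hR : r ≤ R) (hx : x ∈ Metric.ball c r) :
    (∫⁻ y in Metric.ball c r, f y ∂μ) / μ (Metric.ball c r) ≤ restrictedMaximal μ Z R f x :=
  le_iSup_of_le c (le_iSup_of_le r (le_iSup_of_le ⟨hc, hr, hR, hx⟩ le_rfl))

theorem measurable_restrictedMaximal [OpensMeasurableSpace α] (f : α → ℝ≥0∞) :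
    Measurable (restrictedMaximal μ Z R f) := by
  refine measurable_of_Ioi fun t => IsOpen.measurableSet ?_
  rw [Metric.isOpen_iff]
  intro x hx
  obtain ⟨c, hc, r, hr, hR, hxr, ht⟩ := lt_restrictedMaximal_iff.1 hx
  obtain ⟨ε, hε, hsub⟩ := Metric.isOpen_iff.1 Metric.isOpen_ball x hxr
  exact ⟨ε, hε, fun y hy => lt_restrictedMaximal_iff.2 ⟨c, hc, r, hr, hR, hsub hy, ht⟩⟩

/-- Vitali covering: a disjoint subfamily of the balls with large average has fivefold enlargements
covering the superlevel set. Doubling is needed only for balls of the family. -/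
theorem restrictedMaximal_weak_type [OpensMeasurableSpace α] [TopologicalSpace.SeparableSpace α]
    {D : ℝ≥0∞}
    (hD : ∀ c ∈ Z, ∀ r, 0 < r → r ≤ R → μ (Metric.ball c (5 * r)) ≤ D * μ (Metric.ball c r))
    (f : α → ℝ≥0∞) (t : ℝ≥0∞) :
    t * μ {x | t < restrictedMaximal μ Z R f x} ≤ D * ∫⁻ x, f x ∂μ := by
  let T : Set (α × ℝ) := {a | a.1 ∈ Z ∧ 0 < a.2 ∧ a.2 ≤ R ∧
    t < (∫⁻ y in Metric.ball a.1 a.2, f y ∂μ) / μ (Metric.ball a.1 a.2)}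
  obtain ⟨u, huT, hdisj, hcov⟩ := Vitali.exists_disjoint_subfamily_covering_enlargement
    (fun a : α × ℝ => Metric.ball a.1 a.2) T (fun a => a.2) 2 one_lt_two
    (fun a ha => ha.2.1.le) R (fun a ha => ha.2.2.1)
    (fun a ha => ⟨a.1, Metric.mem_ball_self ha.2.1⟩)
  have hcount : u.Countable := hdisj.countable_of_isOpen (fun _ _ => Metric.isOpen_ball)
    (fun a ha => ⟨a.1, Metric.mem_ball_self (huT ha).2.1⟩)
  have hsub : {x | t < restrictedMaximal μ Z R f x} ⊆
      ⋃ b ∈ u, Metric.ball b.1 (5 * b.2) := by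
    intro x hx
    obtain ⟨c, hc, r, hr, hR, hxr, ht⟩ := lt_restrictedMaximal_iff.1 hx
    obtain ⟨b, hb, ⟨y, hy1, hy2⟩, hδ⟩ := hcov (c, r) ⟨hc, hr, hR, ht⟩
    -- The selected ball meets the given one and has radius at least r / 2, so the triangle
    -- inequality gives the factor 2 + 2 + 1 = 5.
    refine mem_biUnion hb ?_
    simp only [Metric.mem_ball] at *
    have h1 := dist_triangle4 x c y b.1
    rw [dist_comm c y] at h1
    linarith
  have : Countable u := hcount.to_subtype
  calc t * μ {x | t < restrictedMaximal μ Z R f x}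
      ≤ t * ∑' b : u, μ (Metric.ball b.1.1 (5 * b.1.2)) := by
        gcongr
        exact (measure_mono hsub).trans (measure_biUnion_le μ hcount _)
    _ ≤ t * ∑' b : u, D * μ (Metric.ball b.1.1 b.1.2) := by
        gcongr with b
        exact hD _ (huT b.2).1 _ (huT b.2).2.1 (huT b.2).2.2.1
    _ = D * ∑' b : u, t * μ (Metric.ball b.1.1 b.1.2) := by
        rw [ENNReal.tsum_mul_left, ENNReal.tsum_mul_left]; ring
    _ ≤ D * ∑' b : u, ∫⁻ y in Metric.ball b.1.1 b.1.2, f y ∂μ := by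
        gcongr with b
        exact ENNReal.mul_le_of_le_div (huT b.2).2.2.2.le
    _ = D * ∫⁻ y in ⋃ b ∈ u, Metric.ball b.1 b.2, f y ∂μ := by
        rw [lintegral_biUnion hcount (fun _ _ => Metric.isOpen_ball.measurableSet) hdisj]
    _ ≤ D * ∫⁻ x, f x ∂μ := by
        gcongr
        exact Measure.restrict_le_self

theorem restrictedMaximal_le_truncation [OpensMeasurableSpace α] {f : α → ℝ≥0∞}
    (hf : Measurable f) (t : ℝ≥0∞) (x : α) :
    restrictedMaximal μ Z R f x ≤ restrictedMaximal μ Z R ({y | t < f y}.indicator f) x + t := by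
  refine iSup_le fun c => iSup_le fun r => iSup_le fun h => ?_
  refine le_trans ?_ (add_le_add_left
    (average_le_restrictedMaximal _ h.1 h.2.1 h.2.2.1 h.2.2.2) t)
  have h1 : ∫⁻ y in Metric.ball c r, f y ∂μ ≤
      (∫⁻ y in Metric.ball c r, {y | t < f y}.indicator f y ∂μ) + t * μ (Metric.ball c r) := by
    rw [← setLIntegral_const,
      ← lintegral_add_left (hf.indicator (measurableSet_lt (by fun_prop) hf))]
    refine lintegral_mono fun y => ?_
    by_cases hy : t < f y
    · simp [hy]
    · simpa [hy] using not_lt.1 hy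
  calc _ ≤ ((∫⁻ y in Metric.ball c r, {y | t < f y}.indicator f y ∂μ) +
        t * μ (Metric.ball c r)) / μ (Metric.ball c r) := by gcongr
    _ ≤ _ := by
      rw [ENNReal.add_div]
      gcongr
      exact ENNReal.div_le_of_le_mul le_rfl

/-- Layer cake formula for a single value. The value ∞ is handled by comparison with every finite
one. -/
theorem rpow_eq_setLIntegral {q : ℝ} (hq : 0 < q) (x : ℝ≥0∞) :
    x ^ q = ∫⁻ t in Ioi (0 : ℝ),
      {t : ℝ | ENNReal.ofReal t < x}.indicator (fun t => ENNReal.ofReal (q * t ^ (q - 1))) t := by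
  have hfin : ∀ b : ℝ, 0 ≤ b → ∫⁻ t in Ioi (0 : ℝ), {t : ℝ | ENNReal.ofReal t <
      ENNReal.ofReal b}.indicator (fun t => ENNReal.ofReal (q * t ^ (q - 1))) t =
      ENNReal.ofReal b ^ q := by
    intro b hb
    have hm : MeasurableSet {t : ℝ | ENNReal.ofReal t < ENNReal.ofReal b} :=
      measurableSet_lt ENNReal.measurable_ofReal measurable_const
    rw [setLIntegral_indicator hm]
    have hs : {t : ℝ | ENNReal.ofReal t < ENNReal.ofReal b} ∩ Ioi 0 = Ioo 0 b := by
      ext t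
      simp only [mem_inter_iff, mem_ofPred_eq, mem_Ioi, mem_Ioo]
      constructor
      · rintro ⟨h1, h2⟩
        exact ⟨h2, (ENNReal.ofReal_lt_ofReal_iff_of_nonneg h2.le).1 h1⟩
      · rintro ⟨h1, h2⟩
        exact ⟨(ENNReal.ofReal_lt_ofReal_iff_of_nonneg h1.le).2 h2, h1⟩
    have hii : IntervalIntegrable (fun t : ℝ => q * t ^ (q - 1)) volume 0 b :=
      (intervalIntegral.intervalIntegrable_rpow' (by linarith)).const_mul q
    rw [hs, Measure.restrict_congr_set Ioo_ae_eq_Ioc, ← ofReal_integral_eq_lintegral_ofReal hii.1,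
      ← intervalIntegral.integral_of_le hb, intervalIntegral.integral_const_mul,
      integral_rpow (Or.inl (by linarith)), ENNReal.ofReal_rpow_of_nonneg hb hq.le]
    · congr 1
      rw [sub_add_cancel, Real.zero_rpow hq.ne']
      field_simp
      ring
    · filter_upwards [ae_restrict_mem measurableSet_Ioc] with t ht
      have := ht.1
      positivity
  rcases eq_or_ne x ∞ with rfl | hx
  · rw [ENNReal.top_rpow_of_pos hq, eq_comm]
    refine ENNReal.eq_top_of_forall_nnreal_le fun y => ?_
    have h := hfin ((y : ℝ) ^ (1 / q)) (by positivity)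
    rw [ENNReal.ofReal_rpow_of_nonneg (by positivity) hq.le, ← Real.rpow_mul y.coe_nonneg,
      one_div_mul_cancel hq.ne', Real.rpow_one, ENNReal.ofReal_coe_nnreal] at h
    rw [← h]
    refine lintegral_mono fun t => indicator_le_indicator_of_subset (fun s _ => ?_)
      (fun _ => zero_le) t
    exact ENNReal.ofReal_lt_top
  · have h := hfin x.toReal ENNReal.toReal_nonneg
    rw [ENNReal.ofReal_toReal hx] at h
    exact h.symm

/-- Marcinkiewicz interpolation between the weak type bound and the trivial bound at infinity: at
height t only the part of f above t / 2 matters. -/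
theorem restrictedMaximal_strong_type [OpensMeasurableSpace α]
    [TopologicalSpace.SeparableSpace α] [SFinite μ] {D : ℝ≥0∞} (hD' : D ≠ ∞)
    (hD : ∀ c ∈ Z, ∀ r, 0 < r → r ≤ R → μ (Metric.ball c (5 * r)) ≤ D * μ (Metric.ball c r))
    {q : ℝ} (hq : 1 < q) :
    ∃ N : ℝ≥0∞, N ≠ ∞ ∧ ∀ f : α → ℝ≥0∞, Measurable f →
      ∫⁻ x, restrictedMaximal μ Z R f x ^ q ∂μ ≤ N * ∫⁻ x, f x ^ q ∂μ := by
  have hq0 : 0 < q := by linarith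
  have hq1 : 0 < q - 1 := by linarith
  refine ⟨2 * D * ENNReal.ofReal (q / (q - 1)) * 2 ^ (q - 1), ?_, fun f hf => ?_⟩
  · exact ENNReal.mul_ne_top (ENNReal.mul_ne_top (ENNReal.mul_ne_top (by simp) hD') (by simp))
      (ENNReal.rpow_ne_top_of_nonneg hq1.le (by simp))
  set g := restrictedMaximal μ Z R f
  have hgm : Measurable g := measurable_restrictedMaximal f
  have hwk : ∀ t : ℝ, 0 < t → μ {x | ENNReal.ofReal t < g x} ≤
      2 * D / ENNReal.ofReal t * ∫⁻ x, {x | ENNReal.ofReal t < 2 * f x}.indicator f x ∂μ := by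
    intro t ht
    have ht2 : ENNReal.ofReal t = 2 * ENNReal.ofReal (t / 2) := by
      rw [← ENNReal.ofReal_ofNat 2, ← ENNReal.ofReal_mul (by norm_num)]
      congr 1; ring
    have h1 : {x | ENNReal.ofReal t < g x} ⊆ {x | ENNReal.ofReal (t / 2) <
        restrictedMaximal μ Z R ({y | ENNReal.ofReal (t / 2) < f y}.indicator f) x} := by
      intro x hx
      by_contra hcon
      have h2 := restrictedMaximal_le_truncation (μ := μ) (Z := Z) (R := R) hf
        (ENNReal.ofReal (t / 2)) x
      have h3 : g x ≤ ENNReal.ofReal (t / 2) + ENNReal.ofReal (t / 2) :=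
        h2.trans (add_le_add_left (not_lt.1 hcon) _)
      rw [← two_mul, ← ht2] at h3
      exact absurd hx (not_lt.2 h3)
    have h2 := restrictedMaximal_weak_type hD ({y | ENNReal.ofReal (t / 2) < f y}.indicator f)
      (ENNReal.ofReal (t / 2))
    have h3 : {x | ENNReal.ofReal t < 2 * f x} = {y | ENNReal.ofReal (t / 2) < f y} := by
      ext x
      simp only [mem_ofPred_eq, ht2]
      exact ENNReal.mul_lt_mul_iff_right (by simp) (by simp)
    rw [h3]
    have ht0 : ENNReal.ofReal (t / 2) ≠ 0 := by simpa using ht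
    calc μ {x | ENNReal.ofReal t < g x} ≤ _ := measure_mono h1
      _ ≤ (D * ∫⁻ x, {y | ENNReal.ofReal (t / 2) < f y}.indicator f x ∂μ) /
          ENNReal.ofReal (t / 2) := by
        rw [ENNReal.le_div_iff_mul_le (Or.inl ht0) (Or.inl ENNReal.ofReal_ne_top), mul_comm]
        exact h2
      _ = _ := by
        rw [ht2, ENNReal.mul_div_mul_left _ _ (by simp) (by simp)]
        simp only [div_eq_mul_inv]
        ring
  have hm2 : Measurable fun p : α × ℝ => {t : ℝ | ENNReal.ofReal t < g p.1}.indicator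
      (fun t => ENNReal.ofReal (q * t ^ (q - 1))) p.2 := by
    have : MeasurableSet {p : α × ℝ | ENNReal.ofReal p.2 < g p.1} :=
      measurableSet_lt (by fun_prop) (by fun_prop)
    exact Measurable.indicator (f := fun p : α × ℝ => ENNReal.ofReal (q * p.2 ^ (q - 1)))
      (by fun_prop) this
  have hm3 : Measurable fun p : α × ℝ => f p.1 *
      {t : ℝ | ENNReal.ofReal t < 2 * f p.1}.indicator
      (fun t => ENNReal.ofReal ((q - 1) * t ^ (q - 1 - 1))) p.2 := by
    have : MeasurableSet {p : α × ℝ | ENNReal.ofReal p.2 < 2 * f p.1} :=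
      measurableSet_lt (by fun_prop) (by fun_prop)
    exact (hf.comp measurable_fst).mul
      (Measurable.indicator (f := fun p : α × ℝ => ENNReal.ofReal ((q - 1) * p.2 ^ (q - 1 - 1)))
      (by fun_prop) this)
  calc ∫⁻ x, g x ^ q ∂μ
      = ∫⁻ x, (∫⁻ t in Ioi (0 : ℝ), {t : ℝ | ENNReal.ofReal t < g x}.indicator
          (fun t => ENNReal.ofReal (q * t ^ (q - 1))) t) ∂μ :=
        lintegral_congr fun x => rpow_eq_setLIntegral hq0 _
    _ = ∫⁻ t in Ioi (0 : ℝ), ∫⁻ x, {t : ℝ | ENNReal.ofReal t < g x}.indicator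
          (fun t => ENNReal.ofReal (q * t ^ (q - 1))) t ∂μ :=
        lintegral_lintegral_swap hm2.aemeasurable
    _ = ∫⁻ t in Ioi (0 : ℝ), ENNReal.ofReal (q * t ^ (q - 1)) *
          μ {x | ENNReal.ofReal t < g x} := by
        refine lintegral_congr fun t => ?_
        rw [← lintegral_indicator_const (measurableSet_lt measurable_const hgm)]
        rfl
    _ ≤ ∫⁻ t in Ioi (0 : ℝ), 2 * D * ENNReal.ofReal (q / (q - 1)) *
          ∫⁻ x, f x * {t : ℝ | ENNReal.ofReal t < 2 * f x}.indicator
          (fun t => ENNReal.ofReal ((q - 1) * t ^ (q - 1 - 1))) t ∂μ := by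
        refine setLIntegral_mono' measurableSet_Ioi fun t ht => ?_
        have ht : 0 < t := ht
        have h1 : ∫⁻ x, f x * {t : ℝ | ENNReal.ofReal t < 2 * f x}.indicator
            (fun t => ENNReal.ofReal ((q - 1) * t ^ (q - 1 - 1))) t ∂μ =
            ENNReal.ofReal ((q - 1) * t ^ (q - 1 - 1)) *
            ∫⁻ x, {x | ENNReal.ofReal t < 2 * f x}.indicator f x ∂μ := by
          rw [← lintegral_const_mul _
            (hf.indicator (measurableSet_lt measurable_const (by fun_prop)))]
          refine lintegral_congr fun x => ?_
          by_cases hx : ENNReal.ofReal t < 2 * f x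
          · rw [indicator_of_mem (by exact hx), indicator_of_mem (by exact hx), mul_comm]
          · rw [indicator_of_notMem (by exact hx), indicator_of_notMem (by exact hx), mul_zero,
              mul_zero]
        rw [h1]
        refine (mul_le_mul_right (hwk t ht) _).trans (le_of_eq ?_)
        -- The weight is rewritten as the layer cake density for the exponent q - 1, so that the
        -- t-integral becomes (2 f)^(q - 1).
        have h2 : ENNReal.ofReal (q * t ^ (q - 1)) / ENNReal.ofReal t =
            ENNReal.ofReal (q / (q - 1)) * ENNReal.ofReal ((q - 1) * t ^ (q - 1 - 1)) := by
          rw [← ENNReal.ofReal_div_of_pos ht, ← ENNReal.ofReal_mul (by positivity),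
            Real.rpow_sub_one ht.ne' (q - 1)]
          congr 1
          field_simp
        rw [mul_assoc (2 * D), ← mul_assoc (ENNReal.ofReal (q / (q - 1))), ← h2]
        simp only [div_eq_mul_inv]
        ring
    _ = 2 * D * ENNReal.ofReal (q / (q - 1)) * ∫⁻ x, (∫⁻ t in Ioi (0 : ℝ),
          f x * {t : ℝ | ENNReal.ofReal t < 2 * f x}.indicator
          (fun t => ENNReal.ofReal ((q - 1) * t ^ (q - 1 - 1))) t) ∂μ := by
        rw [lintegral_const_mul _ hm3.lintegral_prod_left']
        congr 1
        exact (lintegral_lintegral_swap hm3.aemeasurable).symm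
    _ = 2 * D * ENNReal.ofReal (q / (q - 1)) * ∫⁻ x, 2 ^ (q - 1) * f x ^ q ∂μ := by
        congr 1
        refine lintegral_congr fun x => ?_
        rw [lintegral_const_mul, ← rpow_eq_setLIntegral hq1, ENNReal.mul_rpow_of_nonneg _ _ hq1.le]
        · rw [mul_left_comm]
          nth_rewrite 1 [← ENNReal.rpow_one (f x)]
          rw [← ENNReal.rpow_add_of_nonneg _ _ zero_le_one hq1.le, add_sub_cancel]
        · exact Measurable.indicator (by fun_prop) (measurableSet_lt (by fun_prop) (by fun_prop))
    _ = _ := by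
        rw [lintegral_const_mul _ (by fun_prop)]
        ring

end RestrictedMaximal

/-! ### The maximal function over discs centred on the unit circle. -/

/-- Area measure on the disc. -/
abbrev discMeasure : Measure ℂ := volume.restrict disc

/-- The maximal function over discs centred on the unit circle; the average over a disc is
normalized by the square of the radius. -/
def ballMaximal (f : ℂ → ℝ≥0∞) (z : ℂ) : ℝ≥0∞ :=
  ⨆ (c : ℂ) (r : ℝ) (_ : ‖c‖ = 1 ∧ 0 < r ∧ z ∈ Metric.ball c r),
    (∫⁻ y in Metric.ball c r, f y ∂discMeasure) / ENNReal.ofReal (r ^ 2)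

theorem measurableSet_disc : MeasurableSet disc := Metric.isOpen_ball.measurableSet

theorem average_le_ballMaximal (f : ℂ → ℝ≥0∞) {c z : ℂ} {r : ℝ} (hc : ‖c‖ = 1) (hr : 0 < r)
    (hz : z ∈ Metric.ball c r) :
    (∫⁻ y in Metric.ball c r, f y ∂discMeasure) / ENNReal.ofReal (r ^ 2) ≤ ballMaximal f z :=
  le_iSup_of_le c (le_iSup_of_le r (le_iSup_of_le ⟨hc, hr, hz⟩ le_rfl))

theorem lt_ballMaximal_iff {f : ℂ → ℝ≥0∞} {z : ℂ} {t : ℝ≥0∞} :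
    t < ballMaximal f z ↔ ∃ c r, (‖c‖ = 1 ∧ 0 < r ∧ z ∈ Metric.ball c r) ∧
      t < (∫⁻ y in Metric.ball c r, f y ∂discMeasure) / ENNReal.ofReal (r ^ 2) := by
  simp only [ballMaximal, lt_iSup_iff, exists_prop]

theorem measurable_ballMaximal (f : ℂ → ℝ≥0∞) : Measurable (ballMaximal f) := by
  refine measurable_of_Ioi fun t => IsOpen.measurableSet ?_
  rw [Metric.isOpen_iff]
  intro x hx
  obtain ⟨c, r, ⟨hc, hr, hxr⟩, ht⟩ := lt_ballMaximal_iff.1 hx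
  obtain ⟨ε, hε, hsub⟩ := Metric.isOpen_iff.1 Metric.isOpen_ball x hxr
  exact ⟨ε, hε, fun y hy => lt_ballMaximal_iff.2 ⟨c, r, ⟨hc, hr, hsub hy⟩, ht⟩⟩

theorem ballMaximal_mono_ae {f g : ℂ → ℝ≥0∞} (h : f ≤ᵐ[discMeasure] g) (z : ℂ) :
    ballMaximal f z ≤ ballMaximal g z := by
  refine iSup_mono fun c => iSup_mono fun r => iSup_mono fun _ => ?_
  gcongr ?_ / _
  exact lintegral_mono_ae (ae_restrict_of_ae h)

theorem ballMaximal_const_mul {C : ℝ≥0∞} (hC : C ≠ ∞) (f : ℂ → ℝ≥0∞) (z : ℂ) :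
    ballMaximal (fun y => C * f y) z = C * ballMaximal f z := by
  simp only [ballMaximal, ENNReal.mul_iSup]
  refine iSup_congr fun c => iSup_congr fun r => iSup_congr fun _ => ?_
  rw [lintegral_const_mul' _ _ hC, mul_div_assoc]

/-- Monotone convergence in each disc; this carries the estimates of the iteration to its limit. -/
theorem ballMaximal_iSup_le {f : ℕ → ℂ → ℝ≥0∞} (hf : ∀ n, Measurable (f n)) (hmono : Monotone f)
    (z : ℂ) : ballMaximal (fun y => ⨆ n, f n y) z ≤ ⨆ n, ballMaximal (f n) z := by
  refine iSup_le fun c => iSup_le fun r => iSup_le fun h => ?_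
  rw [lintegral_iSup hf hmono, ENNReal.iSup_div]
  exact iSup_mono fun n => average_le_ballMaximal _ h.1 h.2.1 h.2.2

theorem disc_subset_ball {c : ℂ} (hc : ‖c‖ = 1) {r : ℝ} (hr : 2 ≤ r) :
    disc ⊆ Metric.ball c r := by
  intro z hz
  simp only [disc, Metric.mem_ball, dist_zero_right] at hz
  rw [Metric.mem_ball, dist_eq_norm]
  linarith [norm_sub_le z c]

theorem restrict_ball_eq {c : ℂ} (hc : ‖c‖ = 1) {r : ℝ} (hr : 2 ≤ r) :
    discMeasure.restrict (Metric.ball c r) = discMeasure := by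
  rw [Measure.restrict_restrict Metric.isOpen_ball.measurableSet,
    inter_eq_right.2 (disc_subset_ball hc hr)]

/-- The disc of radius r / 4 about (1 - r/4) c lies in both sets. The constant is 4², with π ≥ 1
discarded. -/
theorem sq_le_discMeasure_ball {c : ℂ} (hc : ‖c‖ = 1) {r : ℝ} (hr : 0 < r) (hr2 : r ≤ 2) :
    ENNReal.ofReal (r ^ 2) ≤ 16 * discMeasure (Metric.ball c r) := by
  have hsub : Metric.ball (((1 - r / 4 : ℝ) : ℂ) * c) (r / 4) ⊆ Metric.ball c r ∩ disc := by
    intro z hz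
    rw [Metric.mem_ball, dist_eq_norm] at hz
    have h1 : ‖((1 - r / 4 : ℝ) : ℂ) * c‖ = 1 - r / 4 := by
      rw [norm_mul, hc, Complex.norm_real, Real.norm_of_nonneg (by linarith), mul_one]
    have h2 : ‖((1 - r / 4 : ℝ) : ℂ) * c - c‖ = r / 4 := by
      have : ((1 - r / 4 : ℝ) : ℂ) * c - c = ((-(r / 4) : ℝ) : ℂ) * c := by push_cast; ring
      rw [this, norm_mul, hc, Complex.norm_real, norm_neg, Real.norm_of_nonneg (by linarith),
        mul_one]
    simp only [disc, mem_inter_iff, Metric.mem_ball, dist_eq_norm, sub_zero]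
    have h3 := norm_sub_le_norm_sub_add_norm_sub z (((1 - r / 4 : ℝ) : ℂ) * c) c
    have h4 := norm_sub_norm_le z (((1 - r / 4 : ℝ) : ℂ) * c)
    constructor <;> linarith
  have h5 := measure_mono (μ := volume) hsub
  rw [Measure.restrict_apply Metric.isOpen_ball.measurableSet]
  rw [Complex.volume_ball] at h5
  refine le_trans ?_ (mul_le_mul_right h5 16)
  have h6 : (1 : ℝ≥0∞) ≤ NNReal.pi := by
    exact_mod_cast (show (1 : ℝ) ≤ Real.pi by linarith [Real.pi_gt_three])
  calc ENNReal.ofReal (r ^ 2) = 16 * (ENNReal.ofReal (r / 4) ^ 2 * 1) := by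
        rw [mul_one, ← ENNReal.ofReal_pow (by positivity), ← ENNReal.ofReal_ofNat 16,
          ← ENNReal.ofReal_mul (by norm_num)]
        congr 1; ring
    _ ≤ _ := by gcongr

theorem discMeasure_ball_pos {c : ℂ} (hc : ‖c‖ = 1) {r : ℝ} (hr : 0 < r) (hr2 : r ≤ 2) :
    discMeasure (Metric.ball c r) ≠ 0 := by
  intro h
  have := sq_le_discMeasure_ball hc hr hr2
  rw [h, mul_zero, nonpos_iff_eq_zero, ENNReal.ofReal_eq_zero] at this
  have := pow_pos hr 2
  linarith

/-- It suffices to consider radii at most `2` in the definition of `ballMaximal`. -/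
theorem ballMaximal_le_of_forall_le_two {f : ℂ → ℝ≥0∞} {z : ℂ} (hz : z ∈ disc) {a : ℝ≥0∞}
    (h : ∀ c r, ‖c‖ = 1 → 0 < r → r ≤ 2 → z ∈ Metric.ball c r →
      (∫⁻ y in Metric.ball c r, f y ∂discMeasure) / ENNReal.ofReal (r ^ 2) ≤ a) :
    ballMaximal f z ≤ a := by
  refine iSup_le fun c => iSup_le fun r => iSup_le fun hr => ?_
  rcases le_total r 2 with h2 | h2
  · exact h c r hr.1 hr.2.1 h2 hr.2.2
  · refine le_trans ?_ (h c 2 hr.1 two_pos le_rfl (disc_subset_ball hr.1 le_rfl hz))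
    rw [restrict_ball_eq hr.1 h2, restrict_ball_eq hr.1 le_rfl]
    gcongr

/-! ### Weighted estimates for `B_p` weights on these discs. -/

/-- The `B_p` condition with `p = s + 1` over discs centred on the unit circle. -/
structure IsBallBp (s : ℝ) (W : ℂ → ℝ≥0∞) (K : ℝ≥0∞) : Prop where
  measurable : Measurable W
  ne_zero : ∀ z, W z ≠ 0
  ne_top : ∀ z, W z ≠ ∞
  const_ne_top : K ≠ ∞
  le : ∀ c r, ‖c‖ = 1 → 0 < r → (∫⁻ y in Metric.ball c r, W y ∂discMeasure) *
    (∫⁻ y in Metric.ball c r, W y ^ (-(1 / s)) ∂discMeasure) ^ s ≤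
      K * ENNReal.ofReal (r ^ 2) ^ (s + 1)

variable {s : ℝ} {W : ℂ → ℝ≥0∞} {K : ℝ≥0∞}

/-- The condition is symmetric under W ↦ W^(-1/s), s ↦ 1/s, after raising it to the power 1/s. Each
result on W thus also serves for the dual weight. -/
theorem IsBallBp.dual (h : IsBallBp s W K) (hs : 0 < s) :
    IsBallBp (1 / s) (fun z => W z ^ (-(1 / s))) (K ^ (1 / s)) where
  measurable := h.measurable.pow_const _
  ne_zero z := by simp [ENNReal.rpow_eq_zero_iff, h.ne_zero z, h.ne_top z]
  ne_top z := ENNReal.rpow_ne_top_of_ne_zero (h.ne_zero z) (h.ne_top z)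
  const_ne_top := ENNReal.rpow_ne_top_of_nonneg (by positivity) h.const_ne_top
  le c r hc hr := by
    have h1 : ∀ y, (W y ^ (-(1 / s))) ^ (-(1 / (1 / s))) = W y := fun y => by
      rw [← ENNReal.rpow_mul]
      have : -(1 / s) * -(1 / (1 / s)) = 1 := by field_simp
      rw [this, ENNReal.rpow_one]
    simp only [h1]
    have h2 := ENNReal.rpow_le_rpow (h.le c r hc hr) (z := 1 / s) (by positivity)
    rw [ENNReal.mul_rpow_of_nonneg _ _ (by positivity), ENNReal.mul_rpow_of_nonneg _ _
      (by positivity), ← ENNReal.rpow_mul, ← ENNReal.rpow_mul, mul_one_div_cancel hs.ne',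
      ENNReal.rpow_one, mul_comm] at h2
    convert h2 using 3
    field_simp
    ring

/-- Hölder's inequality for 1 = W^(1/p) W^(-1/p), p = s + 1: the lower bound opposite to the `B_p`
upper bound. -/
theorem measure_rpow_le_lintegral_mul (h : IsBallBp s W K) (hs : 0 < s) (E : Set ℂ) :
    discMeasure E ^ (s + 1) ≤ (∫⁻ y in E, W y ∂discMeasure) *
      (∫⁻ y in E, W y ^ (-(1 / s)) ∂discMeasure) ^ s := by
  have hp : 0 < s + 1 := by linarith
  have hpq : (s + 1).HolderConjugate ((s + 1) / s) := by
    rw [Real.holderConjugate_iff]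
    refine ⟨by linarith, ?_⟩
    field_simp
    ring
  have hm := h.measurable
  have h1 := ENNReal.lintegral_mul_le_Lp_mul_Lq (discMeasure.restrict E) hpq
    (f := fun y => W y ^ (1 / (s + 1))) (g := fun y => W y ^ (-(1 / (s + 1))))
    (by fun_prop) (by fun_prop)
  have h2 : ∀ y, W y ^ (1 / (s + 1)) * W y ^ (-(1 / (s + 1))) = 1 := fun y => by
    rw [← ENNReal.rpow_add _ _ (h.ne_zero y) (h.ne_top y), add_neg_cancel, ENNReal.rpow_zero]
  have h3 : ∀ y, (W y ^ (1 / (s + 1))) ^ (s + 1) = W y := fun y => by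
    rw [← ENNReal.rpow_mul, one_div_mul_cancel hp.ne', ENNReal.rpow_one]
  have h4 : ∀ y, (W y ^ (-(1 / (s + 1)))) ^ ((s + 1) / s) = W y ^ (-(1 / s)) := fun y => by
    rw [← ENNReal.rpow_mul]
    congr 1
    field_simp
  simp only [Pi.mul_apply, h2, h3, h4, lintegral_one, Measure.restrict_apply_univ] at h1
  have h5 := ENNReal.rpow_le_rpow h1 hp.le
  rw [ENNReal.mul_rpow_of_nonneg _ _ hp.le, ← ENNReal.rpow_mul, ← ENNReal.rpow_mul,
    one_div_mul_cancel hp.ne', ENNReal.rpow_one] at h5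
  convert h5 using 3
  field_simp

theorem IsBallBp.lintegral_pos (h : IsBallBp s W K) {c : ℂ} (hc : ‖c‖ = 1) {r : ℝ} (hr : 0 < r)
    (hr2 : r ≤ 2) : ∫⁻ y in Metric.ball c r, W y ∂discMeasure ≠ 0 := by
  rw [← pos_iff_ne_zero, setLIntegral_pos_iff h.measurable]
  have : Function.support W = univ := by ext z; simp [h.ne_zero z]
  rw [this, univ_inter, pos_iff_ne_zero]
  exact discMeasure_ball_pos hc hr hr2

/-- An infinite integral would violate the `B_p` bound, because the dual integral does not vanish.
-/
theorem IsBallBp.lintegral_ne_top (h : IsBallBp s W K) (hs : 0 < s) {c : ℂ} (hc : ‖c‖ = 1)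
    {r : ℝ} (hr : 0 < r) (hr2 : r ≤ 2) : ∫⁻ y in Metric.ball c r, W y ∂discMeasure ≠ ∞ := by
  intro h1
  have h2 := h.le c r hc hr
  have h3 := (h.dual hs).lintegral_pos hc hr hr2
  rw [h1, ENNReal.top_mul, top_le_iff] at h2
  · exact ENNReal.mul_ne_top h.const_ne_top
      (ENNReal.rpow_ne_top_of_nonneg (by linarith) ENNReal.ofReal_ne_top) h2
  · rw [Ne, ENNReal.rpow_eq_zero_iff_of_pos hs]
    exact h3

/-- A `B_p` weight is doubling on discs centred on the unit circle. -/
theorem IsBallBp.doubling (h : IsBallBp s W K) (hs : 0 < s) :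
    ∃ D : ℝ≥0∞, D ≠ ∞ ∧ ∀ c ∈ {c : ℂ | ‖c‖ = 1}, ∀ r : ℝ, 0 < r → r ≤ 2 →
      discMeasure.withDensity W (Metric.ball c (5 * r)) ≤
        D * discMeasure.withDensity W (Metric.ball c r) := by
  have hs1 : 0 < s + 1 := by linarith
  refine ⟨K * 400 ^ (s + 1), ENNReal.mul_ne_top h.const_ne_top
    (ENNReal.rpow_ne_top_of_nonneg hs1.le (by simp)), fun c hc r hr hr2 => ?_⟩
  have hc : ‖c‖ = 1 := hc
  rw [withDensity_apply _ Metric.isOpen_ball.measurableSet,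
    withDensity_apply _ Metric.isOpen_ball.measurableSet]
  have hE := measure_rpow_le_lintegral_mul h hs (Metric.ball c r)
  have hB := h.le c (5 * r) hc (by positivity)
  have hsub : Metric.ball c r ⊆ Metric.ball c (5 * r) := Metric.ball_subset_ball (by linarith)
  have harea : ENNReal.ofReal ((5 * r) ^ 2) ≤ 400 * discMeasure (Metric.ball c r) := by
    calc ENNReal.ofReal ((5 * r) ^ 2) = 25 * ENNReal.ofReal (r ^ 2) := by
          rw [← ENNReal.ofReal_ofNat 25, ← ENNReal.ofReal_mul (by norm_num)]; congr 1; ring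
      _ ≤ 25 * (16 * discMeasure (Metric.ball c r)) := by
          gcongr; exact sq_le_discMeasure_ball hc hr hr2
      _ = _ := by rw [← mul_assoc]; norm_num
  set a := discMeasure (Metric.ball c r)
  have ha0 : a ^ (s + 1) ≠ 0 := by
    simp [ENNReal.rpow_eq_zero_iff, discMeasure_ball_pos hc hr hr2, hs1.not_gt, a]
  have hat : a ^ (s + 1) ≠ ∞ := by
    refine ENNReal.rpow_ne_top_of_nonneg hs1.le (ne_top_of_le_ne_top ?_
      (Measure.restrict_apply_le _ _))
    simp [Complex.volume_ball, ENNReal.mul_eq_top]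
  refine (ENNReal.mul_le_mul_iff_left ha0 hat).1 ?_
  set w5 := ∫⁻ y in Metric.ball c (5 * r), W y ∂discMeasure
  set w1 := ∫⁻ y in Metric.ball c r, W y ∂discMeasure
  -- Hölder on the small disc, with the dual integral enlarged to the big disc, where the `B_p`
  -- bound then applies.
  calc w5 * a ^ (s + 1) ≤ w5 * (w1 *
        (∫⁻ y in Metric.ball c (5 * r), W y ^ (-(1 / s)) ∂discMeasure) ^ s) := by
        gcongr
        refine hE.trans ?_
        gcongr
    _ = w1 * (w5 * (∫⁻ y in Metric.ball c (5 * r), W y ^ (-(1 / s)) ∂discMeasure) ^ s) := by ring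
    _ ≤ w1 * (K * (400 * a) ^ (s + 1)) := by
        refine mul_le_mul_right (hB.trans ?_) _
        gcongr
    _ = _ := by
        rw [ENNReal.mul_rpow_of_nonneg _ _ hs1.le]; ring

/-- The maximal function with respect to `W dA` over discs centred on the unit circle. -/
abbrev weightedMaximal (W f : ℂ → ℝ≥0∞) : ℂ → ℝ≥0∞ :=
  restrictedMaximal (discMeasure.withDensity W) {c : ℂ | ‖c‖ = 1} 2 f

/-- Lerner's pointwise bound. -/
theorem IsBallBp.ballMaximal_rpow_le (h : IsBallBp s W K) (hs : 0 < s) {f : ℂ → ℝ≥0∞}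
    (hf : Measurable f) {z : ℂ} (hz : z ∈ disc) :
    ballMaximal f z ^ s ≤ 16 * K * weightedMaximal W (fun y =>
      weightedMaximal (fun y => W y ^ (-(1 / s))) (fun y => f y * W y ^ (1 / s)) y ^ s *
        (W y)⁻¹) z := by
  set σ : ℂ → ℝ≥0∞ := fun y => W y ^ (-(1 / s)) with hσ
  set M := weightedMaximal σ (fun y => f y * W y ^ (1 / s))
  set g : ℂ → ℝ≥0∞ := fun y => M y ^ s * (W y)⁻¹ with hg
  have hWm := h.measurable
  have hσm : Measurable σ := (h.dual hs).measurable
  have hMm : Measurable M := measurable_restrictedMaximal _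
  have key : ∀ c r, ‖c‖ = 1 → 0 < r → r ≤ 2 → z ∈ Metric.ball c r →
      ((∫⁻ y in Metric.ball c r, f y ∂discMeasure) / ENNReal.ofReal (r ^ 2)) ^ s ≤
        16 * K * weightedMaximal W g z := by
    intro c r hc hr hr2 hzr
    have hBm : MeasurableSet (Metric.ball c r) := Metric.isOpen_ball.measurableSet
    have hw0 := h.lintegral_pos hc hr hr2
    have hwt := h.lintegral_ne_top hs hc hr hr2
    have hσ0 := (h.dual hs).lintegral_pos hc hr hr2
    have hσt := (h.dual hs).lintegral_ne_top (by positivity) hc hr hr2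
    have hK := h.le c r hc hr
    have ha := sq_le_discMeasure_ball hc hr hr2
    have ha0 : ENNReal.ofReal (r ^ 2) ≠ 0 := by
      simpa using hr.ne'
    have hat : ENNReal.ofReal (r ^ 2) ≠ ∞ := ENNReal.ofReal_ne_top
    set a := ENNReal.ofReal (r ^ 2)
    set F := ∫⁻ y in Metric.ball c r, f y ∂discMeasure
    change ∫⁻ y in Metric.ball c r, σ y ∂discMeasure ≠ 0 at hσ0
    change ∫⁻ y in Metric.ball c r, σ y ∂discMeasure ≠ ∞ at hσt
    change _ * (∫⁻ y in Metric.ball c r, σ y ∂discMeasure) ^ s ≤ _ at hK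
    set S := ∫⁻ y in Metric.ball c r, σ y ∂discMeasure
    set w := ∫⁻ y in Metric.ball c r, W y ∂discMeasure
    -- Since f = (f W^(1/s)) σ, the quotient is a σ-average over a disc that contains y.
    have h1 : ∀ y ∈ Metric.ball c r, F / S ≤ M y := by
      intro y hy
      have h2 := average_le_restrictedMaximal (μ := discMeasure.withDensity σ)
        (Z := {c : ℂ | ‖c‖ = 1}) (R := 2) (fun y => f y * W y ^ (1 / s)) hc hr hr2 hy
      rw [withDensity_apply _ hBm, setLIntegral_withDensity_eq_setLIntegral_mul _ hσm
        (by fun_prop) hBm] at h2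
      convert h2 using 2
      refine lintegral_congr fun x => ?_
      simp only [Pi.mul_apply, hσ]
      rw [mul_left_comm, ← ENNReal.rpow_add _ _ (h.ne_zero x) (h.ne_top x), neg_add_cancel,
        ENNReal.rpow_zero, mul_one]
    -- The constant (F / S)^s is at most M^s throughout the disc, and g W = M^s turns the area
    -- integral into one against W.
    have h2 : (F / S) ^ s * a ≤ 16 * ∫⁻ y in Metric.ball c r, g y ∂discMeasure.withDensity W := by
      calc (F / S) ^ s * a ≤ (F / S) ^ s * (16 * discMeasure (Metric.ball c r)) := by gcongr
        _ = 16 * ∫⁻ y in Metric.ball c r, (F / S) ^ s ∂discMeasure := by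
          rw [setLIntegral_const]; ring
        _ ≤ 16 * ∫⁻ y in Metric.ball c r, M y ^ s ∂discMeasure := by
          refine mul_le_mul_right (setLIntegral_mono' hBm fun y hy => ?_) _
          exact ENNReal.rpow_le_rpow (h1 y hy) hs.le
        _ = _ := by
          rw [setLIntegral_withDensity_eq_setLIntegral_mul _ hWm (by fun_prop) hBm]
          congr 1
          refine lintegral_congr fun y => ?_
          simp only [Pi.mul_apply, hg]
          rw [mul_left_comm, ENNReal.mul_inv_cancel (h.ne_zero y) (h.ne_top y), mul_one]
    have h3 := average_le_restrictedMaximal (μ := discMeasure.withDensity W)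
        (Z := {c : ℂ | ‖c‖ = 1}) (R := 2) g hc hr hr2 hzr
    rw [withDensity_apply _ hBm] at h3
    have h4 : (S / a) ^ s ≤ K * a / w := by
      rw [ENNReal.le_div_iff_mul_le (Or.inl hw0) (Or.inl hwt), ENNReal.div_rpow_of_nonneg _ _ hs.le,
        mul_comm, ← mul_div_assoc]
      refine ENNReal.div_le_of_le_mul (hK.trans (le_of_eq ?_))
      rw [mul_assoc]
      nth_rewrite 2 [← ENNReal.rpow_one a]
      rw [← ENNReal.rpow_add_of_nonneg _ _ zero_le_one hs.le, add_comm]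
    calc (F / a) ^ s = (F / S) ^ s * (S / a) ^ s := by
          rw [← ENNReal.mul_rpow_of_nonneg _ _ hs.le]
          congr 1
          simp only [div_eq_mul_inv]
          rw [mul_assoc, ← mul_assoc S⁻¹, ENNReal.inv_mul_cancel hσ0 hσt, one_mul]
      _ ≤ (F / S) ^ s * (K * a / w) := by gcongr
      _ = K * ((F / S) ^ s * a / w) := by simp only [div_eq_mul_inv]; ring
      _ ≤ K * ((16 * ∫⁻ y in Metric.ball c r, g y ∂discMeasure.withDensity W) / w) := by gcongr
      _ = 16 * K * ((∫⁻ y in Metric.ball c r, g y ∂discMeasure.withDensity W) / w) := by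
          simp only [div_eq_mul_inv]; ring
      _ ≤ _ := by gcongr
  rw [← ENNReal.le_rpow_inv_iff hs]
  refine ballMaximal_le_of_forall_le_two hz fun c r hc hr hr2 hzr => ?_
  rw [ENNReal.le_rpow_inv_iff hs]
  exact key c r hc hr hr2 hzr

/-- The maximal function is bounded on `L^p(W)` for a `B_p` weight `W`, where `p = s + 1`. -/
theorem IsBallBp.lintegral_ballMaximal_le (h : IsBallBp s W K) (hs : 0 < s) :
    ∃ N : ℝ≥0∞, N ≠ ∞ ∧ ∀ f : ℂ → ℝ≥0∞, Measurable f →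
      ∫⁻ z, ballMaximal f z ^ (s + 1) * W z ∂discMeasure ≤
        N * ∫⁻ z, f z ^ (s + 1) * W z ∂discMeasure := by
  have hWm := h.measurable
  have hσm := (h.dual hs).measurable
  have hs1 : 0 < s + 1 := by linarith
  -- The exponent conjugate to s + 1. It raises the s-th power in Lerner's bound to s + 1, and g^q W
  -- = M^(s+1) σ because 1 - q = -1/s.
  set q := (s + 1) / s with hqdef
  have hq : 1 < q := by rw [hqdef, lt_div_iff₀ hs]; linarith
  have hq0 : 0 < q := by linarith
  obtain ⟨D₁, hD₁, hd₁⟩ := h.doubling hs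
  obtain ⟨D₂, hD₂, hd₂⟩ := (h.dual hs).doubling (by positivity)
  obtain ⟨N₁, hN₁, hM₁⟩ := restrictedMaximal_strong_type hD₁ hd₁ hq
  obtain ⟨N₂, hN₂, hM₂⟩ := restrictedMaximal_strong_type hD₂ hd₂ (q := s + 1) (by linarith)
  have hK : (16 * K) ^ q ≠ ∞ := ENNReal.rpow_ne_top_of_nonneg hq0.le
    (ENNReal.mul_ne_top (by simp) h.const_ne_top)
  refine ⟨(16 * K) ^ q * N₁ * N₂, ENNReal.mul_ne_top (ENNReal.mul_ne_top hK hN₁) hN₂,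
    fun f hf => ?_⟩
  set σ : ℂ → ℝ≥0∞ := fun y => W y ^ (-(1 / s)) with hσ
  set M := weightedMaximal σ (fun y => f y * W y ^ (1 / s))
  have hMm : Measurable M := measurable_restrictedMaximal _
  set g : ℂ → ℝ≥0∞ := fun y => M y ^ s * (W y)⁻¹ with hg
  have hgm : Measurable g := by fun_prop
  have hMgm : Measurable (weightedMaximal W g) := measurable_restrictedMaximal _
  calc ∫⁻ z, ballMaximal f z ^ (s + 1) * W z ∂discMeasure
      ≤ ∫⁻ z, (16 * K) ^ q * (W z * weightedMaximal W g z ^ q) ∂discMeasure := by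
        refine setLIntegral_mono' measurableSet_disc fun z hz => ?_
        have h1 := ENNReal.rpow_le_rpow (h.ballMaximal_rpow_le hs hf hz) hq0.le
        rw [← ENNReal.rpow_mul, ENNReal.mul_rpow_of_nonneg _ _ hq0.le, hqdef,
          mul_div_cancel₀ _ hs.ne'] at h1
        calc _ ≤ _ := mul_le_mul_left h1 _
          _ = _ := by ring
    _ = (16 * K) ^ q * ∫⁻ z, weightedMaximal W g z ^ q ∂discMeasure.withDensity W := by
        rw [lintegral_withDensity_eq_lintegral_mul _ hWm (by fun_prop),
          lintegral_const_mul' _ _ hK]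
        rfl
    _ ≤ (16 * K) ^ q * (N₁ * ∫⁻ z, g z ^ q ∂discMeasure.withDensity W) := by
        gcongr; exact hM₁ g hgm
    _ = (16 * K) ^ q * (N₁ * ∫⁻ z, M z ^ (s + 1) ∂discMeasure.withDensity σ) := by
        rw [lintegral_withDensity_eq_lintegral_mul _ hWm (by fun_prop),
          lintegral_withDensity_eq_lintegral_mul _ hσm (by fun_prop)]
        congr 2
        refine lintegral_congr fun z => ?_
        simp only [Pi.mul_apply, hg, hσ]
        rw [ENNReal.mul_rpow_of_nonneg _ _ hq0.le, ← ENNReal.rpow_mul, hqdef,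
          mul_div_cancel₀ _ hs.ne', mul_left_comm, mul_comm]
        congr 1
        rw [ENNReal.inv_rpow, ← ENNReal.rpow_neg]
        nth_rewrite 1 [← ENNReal.rpow_one (W z)]
        rw [← ENNReal.rpow_add _ _ (h.ne_zero z) (h.ne_top z)]
        congr 1
        field_simp
        ring
    _ ≤ (16 * K) ^ q * (N₁ * (N₂ *
          ∫⁻ z, (f z * W z ^ (1 / s)) ^ (s + 1) ∂discMeasure.withDensity σ)) := by
        gcongr; exact hM₂ _ (by fun_prop)
    _ = (16 * K) ^ q * N₁ * N₂ * ∫⁻ z, f z ^ (s + 1) * W z ∂discMeasure := by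
        rw [lintegral_withDensity_eq_lintegral_mul _ hσm (by fun_prop)]
        simp only [mul_assoc]
        congr 3
        refine lintegral_congr fun z => ?_
        simp only [Pi.mul_apply, hσ]
        rw [ENNReal.mul_rpow_of_nonneg _ _ hs1.le, ← ENNReal.rpow_mul, mul_left_comm,
          ← ENNReal.rpow_add _ _ (h.ne_zero z) (h.ne_top z)]
        have : -(1 / s) + 1 / s * (s + 1) = 1 := by field_simp; ring
        rw [this, ENNReal.rpow_one]

/-! ### Jones factorization by a monotone iteration. -/

/-- The operator whose iteration yields the factorization of `W`. -/
def factorizationOperator (s : ℝ) (W u : ℂ → ℝ≥0∞) (z : ℂ) : ℝ≥0∞ :=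
  max (ballMaximal u z) (((W z)⁻¹ * ballMaximal (fun y => W y * u y ^ s) z) ^ (1 / s))

theorem measurable_factorizationOperator (hW : Measurable W) (u : ℂ → ℝ≥0∞) :
    Measurable (factorizationOperator s W u) :=
  (measurable_ballMaximal u).max ((hW.inv.mul (measurable_ballMaximal _)).pow_const _)

theorem factorizationOperator_mono (hs : 0 < s) {u v : ℂ → ℝ≥0∞} (huv : u ≤ v) :
    factorizationOperator s W u ≤ factorizationOperator s W v := by
  intro z
  refine max_le_max (ballMaximal_mono_ae (ae_of_all _ huv) z) ?_
  refine ENNReal.rpow_le_rpow (mul_le_mul_right (ballMaximal_mono_ae (ae_of_all _ fun y => ?_) z) _)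
    (by positivity)
  exact mul_le_mul_right (ENNReal.rpow_le_rpow (huv y) hs.le) _

theorem max_rpow_le_add (a b : ℝ≥0∞) (p : ℝ) : max a b ^ p ≤ a ^ p + b ^ p := by
  rcases le_total a b with h | h
  · rw [max_eq_right h]; exact le_add_self
  · rw [max_eq_left h]; exact le_self_add

/-- The first branch is the bound of M on L^(s+1)(W). The second is the bound for the dual weight at
exponent 1/s + 1, applied to W u^s; the powers of W recombine to u^(s+1) W. -/
theorem IsBallBp.lintegral_factorizationOperator_le (h : IsBallBp s W K) (hs : 0 < s) :
    ∃ N : ℝ≥0∞, N ≠ ∞ ∧ ∀ u : ℂ → ℝ≥0∞, Measurable u →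
      ∫⁻ z, factorizationOperator s W u z ^ (s + 1) * W z ∂discMeasure ≤
        N * ∫⁻ z, u z ^ (s + 1) * W z ∂discMeasure := by
  have hWm := h.measurable
  have hs1 : 0 < s + 1 := by linarith
  obtain ⟨N₁, hN₁, h₁⟩ := h.lintegral_ballMaximal_le hs
  obtain ⟨N₂, hN₂, h₂⟩ := (h.dual hs).lintegral_ballMaximal_le (by positivity)
  refine ⟨N₁ + N₂, ENNReal.add_ne_top.2 ⟨hN₁, hN₂⟩, fun u hu => ?_⟩
  have hm := measurable_ballMaximal u
  have hm' := measurable_ballMaximal (fun y => W y * u y ^ s)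
  calc _ ≤ ∫⁻ z, ballMaximal u z ^ (s + 1) * W z +
        ballMaximal (fun y => W y * u y ^ s) z ^ (1 / s + 1) * W z ^ (-(1 / s)) ∂discMeasure := by
        refine lintegral_mono fun z => ?_
        refine (mul_le_mul_left (max_rpow_le_add _ _ _) _).trans (le_of_eq ?_)
        rw [add_mul]
        congr 1
        have h3 : 1 / s * (s + 1) = 1 / s + 1 := by field_simp; ring
        rw [← ENNReal.rpow_mul, h3, ENNReal.mul_rpow_of_nonneg _ _ (by positivity),
          mul_comm (_ ^ _) (_ ^ _), mul_assoc]
        congr 1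
        rw [ENNReal.inv_rpow, ← ENNReal.rpow_neg]
        nth_rewrite 2 [← ENNReal.rpow_one (W z)]
        rw [← ENNReal.rpow_add _ _ (h.ne_zero z) (h.ne_top z)]
        congr 1
        ring
    _ = (∫⁻ z, ballMaximal u z ^ (s + 1) * W z ∂discMeasure) +
        ∫⁻ z, ballMaximal (fun y => W y * u y ^ s) z ^ (1 / s + 1) * W z ^ (-(1 / s))
          ∂discMeasure := lintegral_add_left (by fun_prop) _
    _ ≤ N₁ * (∫⁻ z, u z ^ (s + 1) * W z ∂discMeasure) +
        N₂ * ∫⁻ z, (W z * u z ^ s) ^ (1 / s + 1) * W z ^ (-(1 / s)) ∂discMeasure :=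
        add_le_add (h₁ u hu) (h₂ _ (by fun_prop))
    _ = _ := by
        rw [add_mul]
        congr 2
        refine lintegral_congr fun z => ?_
        have h3 : s * (1 / s + 1) = s + 1 := by field_simp; ring
        rw [ENNReal.mul_rpow_of_nonneg _ _ (by positivity), ← ENNReal.rpow_mul, h3,
          mul_comm (_ ^ _) (_ ^ _), mul_assoc, ← ENNReal.rpow_add _ _ (h.ne_zero z) (h.ne_top z)]
        congr 1
        have h4 : 1 / s + 1 + -(1 / s) = 1 := by ring
        rw [h4, ENNReal.rpow_one]

/-- The iteration towards a function that dominates `ε` times its image under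
`factorizationOperator`. -/
def factorizationIterate (s : ℝ) (W : ℂ → ℝ≥0∞) (ε : ℝ≥0∞) : ℕ → ℂ → ℝ≥0∞
  | 0 => fun _ => 1
  | n + 1 => fun z => max 1 (ε * factorizationOperator s W (factorizationIterate s W ε n) z)

theorem measurable_factorizationIterate (hW : Measurable W) (ε : ℝ≥0∞) (n : ℕ) :
    Measurable (factorizationIterate s W ε n) := by
  cases n with
  | zero => exact measurable_const
  | succ n => exact measurable_const.max ((measurable_factorizationOperator hW _).const_mul ε)

theorem monotone_factorizationIterate (hs : 0 < s) (ε : ℝ≥0∞) :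
    Monotone (factorizationIterate s W ε) := by
  refine monotone_nat_of_le_succ fun n => ?_
  induction n with
  | zero => exact fun z => le_max_left _ _
  | succ n ih =>
    exact fun z => max_le_max le_rfl (mul_le_mul_right (factorizationOperator_mono hs ih z) _)

/-- Jones factorization: `W = (W * u ^ s) * u ^ (-s)`, with both `u` and `W * u ^ s` in `B_1`. -/
theorem IsBallBp.exists_factorization (h : IsBallBp s W K) (hs : 0 < s) :
    ∃ u : ℂ → ℝ≥0∞, ∃ C : ℝ≥0∞, C ≠ ∞ ∧ Measurable u ∧ (∀ z, 1 ≤ u z) ∧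
      (∀ᵐ z ∂discMeasure, u z ≠ ∞) ∧ (∀ z, ballMaximal u z ≤ C * u z) ∧
      ∀ z, ballMaximal (fun y => W y * u y ^ s) z ≤ C * (W z * u z ^ s) := by
  have hWm := h.measurable
  have hs1 : 0 < s + 1 := by linarith
  obtain ⟨N, hN, hT⟩ := h.lintegral_factorizationOperator_le hs
  -- Chosen so that ε^(s+1) N ≤ 1/2, which makes the bound 2 I below reproduce itself as I + (1/2)(2
  -- I). Using N + 1 keeps ε finite when N = 0.
  set ε : ℝ≥0∞ := ((2 * (N + 1))⁻¹) ^ (1 / (s + 1)) with hε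
  have hNt : 2 * (N + 1) ≠ ∞ := ENNReal.mul_ne_top (by simp) (by simp [hN])
  have hε0 : ε ≠ 0 := by
    rw [hε, Ne, ENNReal.rpow_eq_zero_iff_of_pos (by positivity)]
    exact ENNReal.inv_ne_zero.2 hNt
  have hεt : ε ≠ ∞ := by
    refine ENNReal.rpow_ne_top_of_nonneg (by positivity) (ENNReal.inv_ne_top.2 ?_)
    simp
  have hεN : ε ^ (s + 1) * N ≤ 2⁻¹ := by
    rw [hε, ← ENNReal.rpow_mul, one_div_mul_cancel hs1.ne', ENNReal.rpow_one,
      ENNReal.mul_inv (by simp) (by simp), mul_assoc]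
    refine (mul_le_mul_right ?_ _).trans (mul_one _).le
    rw [mul_comm, ← div_eq_mul_inv]
    exact ENNReal.div_le_of_le_mul (by rw [one_mul]; exact le_self_add)
  clear_value ε
  set U := factorizationIterate s W ε
  have hUm : ∀ n, Measurable (U n) := measurable_factorizationIterate hWm ε
  have hUmono : Monotone U := monotone_factorizationIterate hs ε
  have hzero : ∀ z, U 0 z = 1 := fun z => rfl
  have hsucc : ∀ n z, U (n + 1) z = max 1 (ε * factorizationOperator s W (U n) z) :=
    fun n z => rfl
  clear_value U
  have hstep : ∀ n z, ε * factorizationOperator s W (U n) z ≤ U (n + 1) z :=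
    fun n z => (le_max_right _ _).trans (hsucc n z).ge
  set I := ∫⁻ z, W z ∂discMeasure
  have hIt : I ≠ ∞ := by
    have := h.lintegral_ne_top hs (c := 1) (by simp) two_pos le_rfl
    rwa [restrict_ball_eq (by simp) le_rfl] at this
  have hbound : ∀ n, ∫⁻ z, U n z ^ (s + 1) * W z ∂discMeasure ≤ 2 * I := by
    intro n
    induction n with
    | zero =>
      simp only [hzero, ENNReal.one_rpow, one_mul]
      rw [two_mul]
      exact le_self_add
    | succ n ih =>
      calc _ ≤ ∫⁻ z, W z + ε ^ (s + 1) *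
            (factorizationOperator s W (U n) z ^ (s + 1) * W z) ∂discMeasure := by
            refine lintegral_mono fun z => ?_
            rw [hsucc]
            refine (mul_le_mul_left (max_rpow_le_add _ _ _) _).trans (le_of_eq ?_)
            rw [ENNReal.one_rpow, add_mul, one_mul, ENNReal.mul_rpow_of_nonneg _ _ hs1.le,
              mul_assoc]
        _ = I + ε ^ (s + 1) *
            ∫⁻ z, factorizationOperator s W (U n) z ^ (s + 1) * W z ∂discMeasure := by
            rw [lintegral_add_left hWm,
              lintegral_const_mul' _ _ (ENNReal.rpow_ne_top_of_nonneg hs1.le hεt)]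
        _ ≤ I + ε ^ (s + 1) * (N * (2 * I)) := by
            gcongr
            exact (hT _ (hUm n)).trans (mul_le_mul_right ih _)
        _ ≤ I + 2⁻¹ * (2 * I) := by rw [← mul_assoc]; gcongr
        _ = 2 * I := by
            rw [← mul_assoc, ENNReal.inv_mul_cancel (by simp) (by simp), one_mul, two_mul]
  set u : ℂ → ℝ≥0∞ := fun z => ⨆ n, U n z
  have hum : Measurable u := Measurable.iSup hUm
  have hrpow : ∀ z {t : ℝ}, 0 < t → u z ^ t = ⨆ n, U n z ^ t := fun z t ht =>
    (ENNReal.orderIsoRpow t ht).map_iSup (fun n => U n z)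
  have hint : ∫⁻ z, u z ^ (s + 1) * W z ∂discMeasure ≤ 2 * I := by
    simp only [hrpow _ hs1, ENNReal.iSup_mul]
    rw [lintegral_iSup (fun n => by have := hUm n; fun_prop)]
    · exact iSup_le hbound
    · exact fun m n hmn z => mul_le_mul_left (ENNReal.rpow_le_rpow (hUmono hmn z) hs1.le) _
  refine ⟨u, ε⁻¹ + (ε⁻¹) ^ s, ?_, hum, fun z => (hzero z).ge.trans
    (le_iSup (fun n => U n z) 0), ?_, fun z => ?_,
    fun z => ?_⟩
  · exact ENNReal.add_ne_top.2 ⟨ENNReal.inv_ne_top.2 hε0,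
      ENNReal.rpow_ne_top_of_nonneg hs.le (ENNReal.inv_ne_top.2 hε0)⟩
  -- The uniform L^(s+1)(W) bound survives in the limit and forces u to be finite almost everywhere.
  · have h1 := ae_lt_top (μ := discMeasure) (f := fun z => u z ^ (s + 1) * W z) (by fun_prop)
      (ne_top_of_le_ne_top (ENNReal.mul_ne_top (by simp) hIt) hint)
    filter_upwards [h1] with z hz hz'
    rw [hz', ENNReal.top_rpow_of_pos hs1, ENNReal.top_mul (h.ne_zero z)] at hz
    exact lt_irrefl _ hz
  · refine (ballMaximal_iSup_le hUm hUmono z).trans (iSup_le fun n => ?_)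
    have h1 : ε * ballMaximal (U n) z ≤ u z :=
      ((mul_le_mul_right (le_max_left _ _) _).trans (hstep n z)).trans
        (le_iSup (fun n => U n z) (n + 1))
    calc ballMaximal (U n) z = ε⁻¹ * (ε * ballMaximal (U n) z) := by
          rw [← mul_assoc, ENNReal.inv_mul_cancel hε0 hεt, one_mul]
      _ ≤ ε⁻¹ * u z := by gcongr
      _ ≤ _ := by gcongr; exact le_self_add
  · have h2 : (fun y => W y * u y ^ s) = fun y => ⨆ n, W y * U n y ^ s := by
      ext y
      rw [hrpow _ hs, ENNReal.mul_iSup]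
    rw [h2]
    refine (ballMaximal_iSup_le (f := fun n y => W y * U n y ^ s)
      (fun n => hWm.mul ((hUm n).pow_const s)) (fun m n hmn y =>
      mul_le_mul_right (ENNReal.rpow_le_rpow (hUmono hmn y) hs.le) _) z).trans
      (iSup_le fun n => ?_)
    set A := ballMaximal (fun y => W y * U n y ^ s) z
    have h1 : ε * ((W z)⁻¹ * A) ^ (1 / s) ≤ u z :=
      ((mul_le_mul_right (le_max_right _ _) _).trans (hstep n z)).trans
        (le_iSup (fun n => U n z) (n + 1))
    have h3 := ENNReal.rpow_le_rpow h1 hs.le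
    rw [ENNReal.mul_rpow_of_nonneg _ _ hs.le, ← ENNReal.rpow_mul, one_div_mul_cancel hs.ne',
      ENNReal.rpow_one] at h3
    have hεs0 : ε ^ s ≠ 0 := by rwa [Ne, ENNReal.rpow_eq_zero_iff_of_pos hs]
    have hεst : ε ^ s ≠ ∞ := ENNReal.rpow_ne_top_of_nonneg hs.le hεt
    calc A = (ε⁻¹) ^ s * (W z * (ε ^ s * ((W z)⁻¹ * A))) := by
          rw [ENNReal.inv_rpow, mul_left_comm (W z), ← mul_assoc,
            ENNReal.inv_mul_cancel hεs0 hεst, one_mul, ← mul_assoc,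
            ENNReal.mul_inv_cancel (h.ne_zero z) (h.ne_top z), one_mul]
      _ ≤ (ε⁻¹) ^ s * (W z * u z ^ s) := by gcongr
      _ ≤ _ := by gcongr; exact le_add_self

/-! ### Slow variation of maximal functions in the hyperbolic metric. -/

/-- A disc centred on the circle and containing z has radius at least 1 - |z|. Enlarging the radius
by |ζ - z| captures ζ and costs only the square of the ratio of radii. -/
theorem ballMaximal_le_mul_ballMaximal (f : ℂ → ℝ≥0∞) {z : ℂ} (hz : z ∈ disc) (ζ : ℂ) :
    ballMaximal f z ≤ ENNReal.ofReal ((1 + ‖ζ - z‖ / (1 - ‖z‖)) ^ 2) * ballMaximal f ζ := by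
  have hz1 : 0 < 1 - ‖z‖ := by
    simp only [disc, Metric.mem_ball, dist_zero_right] at hz
    linarith
  refine iSup_le fun c => iSup_le fun r => iSup_le fun ⟨hc, hr, hzr⟩ => ?_
  rw [Metric.mem_ball, dist_eq_norm] at hzr
  set d := ‖ζ - z‖
  have hd0 : 0 ≤ d := norm_nonneg _
  have hζ : ζ ∈ Metric.ball c (r + d) := by
    rw [Metric.mem_ball, dist_eq_norm]
    linarith [norm_sub_le_norm_sub_add_norm_sub ζ z c]
  have hrz : 1 - ‖z‖ ≤ r := by
    have := norm_sub_norm_le c z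
    rw [norm_sub_rev] at this
    linarith
  have hle : (r + d) / r ≤ 1 + d / (1 - ‖z‖) := by
    rw [add_div, div_self hr.ne']
    gcongr
  have h1 := average_le_ballMaximal f hc (by positivity : 0 < r + d) hζ
  have hr2 : 0 < r ^ 2 := by positivity
  have hrd2 : 0 < (r + d) ^ 2 := by positivity
  have h2 : (ENNReal.ofReal (r ^ 2))⁻¹ =
      ENNReal.ofReal (((r + d) / r) ^ 2) * (ENNReal.ofReal ((r + d) ^ 2))⁻¹ := by
    rw [← ENNReal.ofReal_inv_of_pos hr2, ← ENNReal.ofReal_inv_of_pos hrd2,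
      ← ENNReal.ofReal_mul (by positivity)]
    congr 1
    field_simp
  calc (∫⁻ y in Metric.ball c r, f y ∂discMeasure) / ENNReal.ofReal (r ^ 2)
      ≤ (∫⁻ y in Metric.ball c (r + d), f y ∂discMeasure) / ENNReal.ofReal (r ^ 2) := by
        gcongr; linarith
    _ = ENNReal.ofReal (((r + d) / r) ^ 2) *
        ((∫⁻ y in Metric.ball c (r + d), f y ∂discMeasure) / ENNReal.ofReal ((r + d) ^ 2)) := by
        rw [div_eq_mul_inv, h2, mul_left_comm, ← div_eq_mul_inv]
    _ ≤ _ := by gcongr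

theorem norm_one_sub_conj_mul_sq (z ζ : ℂ) :
    ‖1 - (starRingEnd ℂ) ζ * z‖ ^ 2 = ‖ζ - z‖ ^ 2 + (1 - ‖z‖ ^ 2) * (1 - ‖ζ‖ ^ 2) := by
  simp only [← Complex.normSq_eq_norm_sq, Complex.normSq_apply, Complex.sub_re, Complex.sub_im,
    Complex.mul_re, Complex.mul_im, Complex.conj_re, Complex.conj_im, Complex.one_re,
    Complex.one_im]
  ring

/-- With n = |ζ - z| and d = |1 - ζ̄ z|, twice the hyperbolic distance is log((d + n)/(d - n)). The
identity d² - n² = (1 - |z|²)(1 - |ζ|²) ≤ 4 (1 - |z|) d yields n/(1 - |z|) ≤ 4 (d + n)/(d - n). -/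
theorem log_one_add_le_hyperbolicDist {z ζ : ℂ} (hz : z ∈ disc) (hζ : ζ ∈ disc) :
    Real.log (1 + ‖ζ - z‖ / (1 - ‖z‖)) ≤ Real.log 5 + 2 * hyperbolicDist z ζ := by
  simp only [disc, Metric.mem_ball, dist_zero_right] at hz hζ
  have hid := norm_one_sub_conj_mul_sq z ζ
  have hd : 1 - ‖ζ‖ ≤ ‖1 - (starRingEnd ℂ) ζ * z‖ := by
    have h1 := norm_sub_norm_le (1 : ℂ) ((starRingEnd ℂ) ζ * z)
    rw [norm_one, norm_mul, RCLike.norm_conj] at h1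
    nlinarith [norm_nonneg ζ, norm_nonneg z]
  have hρ : pseudoHyperbolicDist z ζ = ‖ζ - z‖ / ‖1 - (starRingEnd ℂ) ζ * z‖ := norm_div _ _
  set d := ‖1 - (starRingEnd ℂ) ζ * z‖
  set n := ‖ζ - z‖
  have hn : 0 ≤ n := norm_nonneg _
  have hd0 : 0 < d := by linarith
  have hz0 := norm_nonneg z
  have hζ0 := norm_nonneg ζ
  have hpos : 0 < (1 - ‖z‖ ^ 2) * (1 - ‖ζ‖ ^ 2) := mul_pos (by nlinarith) (by nlinarith)
  have hnd : n < d := by nlinarith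
  have hE : (1 + pseudoHyperbolicDist z ζ) / (1 - pseudoHyperbolicDist z ζ) = (d + n) / (d - n) := by
    rw [hρ]
    have : d - n ≠ 0 := by linarith
    field_simp
  rw [hyperbolicDist, hE]
  have hE1 : 1 ≤ (d + n) / (d - n) := by rw [le_div_iff₀ (by linarith)]; linarith
  have hkey : n / (1 - ‖z‖) ≤ 4 * ((d + n) / (d - n)) := by
    rw [div_le_iff₀ (by linarith), mul_comm 4, div_mul_eq_mul_div, div_mul_eq_mul_div,
      le_div_iff₀ (by linarith)]
    have h1 : (1 - ‖z‖ ^ 2) * (1 - ‖ζ‖ ^ 2) ≤ (2 * (1 - ‖z‖)) * (2 * d) := by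
      gcongr
      · nlinarith
      · nlinarith
      · nlinarith
    have h2 : n * (d - n) * (d + n) ≤ (d + n) * 4 * (1 - ‖z‖) * (d + n) := by
      have h3 : n * ((1 - ‖z‖ ^ 2) * (1 - ‖ζ‖ ^ 2)) ≤ n * ((2 * (1 - ‖z‖)) * (2 * d)) := by gcongr
      have h4 : 0 ≤ (1 - ‖z‖) * (d ^ 2 + n * d + n ^ 2) :=
        mul_nonneg (by linarith) (by positivity)
      nlinarith
    exact le_of_mul_le_mul_right h2 (by linarith)
  calc _ ≤ Real.log (5 * ((d + n) / (d - n))) := by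
        apply Real.log_le_log
        · have : 0 ≤ n / (1 - ‖z‖) := div_nonneg hn (by linarith)
          linarith
        · linarith
    _ = _ := by
        rw [Real.log_mul (by norm_num) (by positivity)]
        ring

/-! ### Arcs, and Carleson squares compared with discs. -/

theorem circlePoint_eq_exp (t : ℝ) :
    circlePoint t = Complex.exp (Complex.I * ((2 * Real.pi * t : ℝ) : ℂ)) := by
  rw [circlePoint]; congr 1; push_cast; ring

theorem norm_circlePoint (t : ℝ) : ‖circlePoint t‖ = 1 := by
  rw [circlePoint_eq_exp, Complex.norm_exp_I_mul_ofReal]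

theorem continuous_circlePoint : Continuous circlePoint := by
  unfold circlePoint
  fun_prop

theorem circlePoint_add (s t : ℝ) : circlePoint (s + t) = circlePoint s * circlePoint t := by
  rw [circlePoint, circlePoint, circlePoint, ← Complex.exp_add]; congr 1; push_cast; ring

theorem circlePoint_intCast (n : ℤ) : circlePoint n = 1 := by
  rw [circlePoint, ← Complex.exp_int_mul_two_pi_mul_I n]
  congr 1; push_cast; ring

theorem circlePoint_arg (u : ℂ) :
    circlePoint (u.arg / (2 * Real.pi)) = Complex.exp (u.arg * Complex.I) := by
  rw [circlePoint_eq_exp]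
  congr 1
  rw [mul_div_cancel₀ _ (by positivity), mul_comm]

theorem div_norm_eq_circlePoint {u : ℂ} (hu : u ≠ 0) :
    u / (‖u‖ : ℂ) = circlePoint (u.arg / (2 * Real.pi)) := by
  rw [circlePoint_arg, div_eq_iff (by simpa using hu), mul_comm, Complex.norm_mul_exp_arg_mul_I]

theorem norm_circlePoint_sub_le (s t : ℝ) :
    ‖circlePoint s - circlePoint t‖ ≤ 2 * Real.pi * |s - t| := by
  have h1 : circlePoint s - circlePoint t = circlePoint t * (circlePoint (s - t) - 1) := by
    rw [mul_sub, ← circlePoint_add, mul_one, add_sub_cancel]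
  rw [h1, norm_mul, norm_circlePoint, one_mul, circlePoint_eq_exp]
  refine Real.norm_exp_I_mul_ofReal_sub_one_le.trans (le_of_eq ?_)
  rw [Real.norm_eq_abs, abs_mul, abs_of_pos (by positivity)]

/-- Every point close to `x * circlePoint t` has direction close to `circlePoint t`. -/
theorem exists_div_norm_eq_circlePoint {z : ℂ} {x t : ℝ} (hx : 1 / 2 ≤ x)
    (hz : ‖z - x * circlePoint t‖ ≤ 1 / 4) :
    z ≠ 0 ∧ ∃ θ : ℝ, |θ - t| ≤ ‖z - x * circlePoint t‖ ∧ z / (‖z‖ : ℂ) = circlePoint θ := by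
  set u := z * circlePoint (-t) with hu
  have hct : circlePoint t * circlePoint (-t) = 1 := by
    rw [← circlePoint_add, add_neg_cancel]
    simpa using circlePoint_intCast 0
  have hux : ‖u - x‖ = ‖z - x * circlePoint t‖ := by
    have : u - x = (z - x * circlePoint t) * circlePoint (-t) := by
      rw [sub_mul, mul_assoc, hct, mul_one]
    rw [this, norm_mul, norm_circlePoint, mul_one]
  set δ := ‖z - x * circlePoint t‖
  have hre : 1 / 4 ≤ u.re := by
    have h1 := Complex.abs_re_le_norm (u - x)
    rw [Complex.sub_re, Complex.ofReal_re, hux] at h1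
    linarith [(abs_le.1 h1).1]
  have him : |u.im| ≤ δ := by
    have h1 := Complex.abs_im_le_norm (u - x)
    rwa [Complex.sub_im, Complex.ofReal_im, sub_zero, hux] at h1
  have hnorm : 1 / 4 ≤ ‖u‖ := hre.trans (Complex.re_le_norm u)
  have hu0 : u ≠ 0 := norm_pos_iff.1 (by linarith)
  have hzu : ‖z‖ = ‖u‖ := by rw [hu, norm_mul, norm_circlePoint, mul_one]
  refine ⟨norm_pos_iff.1 (by linarith), t + u.arg / (2 * Real.pi), ?_, ?_⟩
  -- Jordan's inequality bounds the argument by the sine, which is Im u / |u| ≤ 4 δ; hence |arg u| ≤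
  -- 2 π δ.
  · have h1 := Real.mul_abs_le_abs_sin (Complex.abs_arg_le_pi_div_two_iff.2 (by linarith : 0 ≤ u.re))
    rw [Complex.sin_arg, abs_div, abs_norm] at h1
    have h2 : |u.im| / ‖u‖ ≤ δ / (1 / 4) := by gcongr
    have h3 := Real.pi_pos
    have h4 : 2 / Real.pi * |u.arg| ≤ 4 * δ := by linarith
    rw [add_sub_cancel_left, abs_div, abs_of_pos (by positivity : 0 < 2 * Real.pi),
      div_le_iff₀ (by positivity)]
    rw [div_mul_eq_mul_div, div_le_iff₀ h3] at h4
    linarith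
  · rw [circlePoint_add, ← div_norm_eq_circlePoint hu0, hzu, mul_div_assoc', hu,
      mul_left_comm, hct, mul_one]

theorem exists_circlePoint_eq {e : ℂ} (he : ‖e‖ = 1) (a : ℝ) :
    ∃ θ ∈ Icc a (a + 1), circlePoint θ = e := by
  have he0 : e ≠ 0 := norm_pos_iff.1 (by rw [he]; exact one_pos)
  have h1 := div_norm_eq_circlePoint he0
  rw [he, Complex.ofReal_one, div_one] at h1
  set τ := e.arg / (2 * Real.pi)
  refine ⟨a + Int.fract (τ - a), ⟨by linarith [Int.fract_nonneg (τ - a)],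
    by linarith [Int.fract_lt_one (τ - a)]⟩, ?_⟩
  have h2 : τ = a + Int.fract (τ - a) + ⌊τ - a⌋ := by
    linarith [Int.fract_add_floor (τ - a)]
  calc circlePoint (a + Int.fract (τ - a))
      = circlePoint (a + Int.fract (τ - a)) * circlePoint ⌊τ - a⌋ := by
        rw [circlePoint_intCast, mul_one]
    _ = circlePoint τ := by rw [← circlePoint_add, ← h2]
    _ = e := h1.symm

/-- An arc differs from a compact one by at most its two endpoints. -/
theorem measurableSet_carlesonSquare {I : Set ℂ} {ℓ : ℝ} (hI : IsArc I ℓ) :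
    MeasurableSet (carlesonSquare I ℓ) := by
  obtain ⟨-, -, a, h1, h2⟩ := hI
  have hIm : MeasurableSet I := by
    have hJ : MeasurableSet (circlePoint '' Icc a (a + ℓ)) :=
      (isCompact_Icc.image continuous_circlePoint).isClosed.measurableSet
    have hfin : (circlePoint '' Icc a (a + ℓ) \ I).Finite := by
      refine Set.Finite.subset (Set.toFinite {circlePoint a, circlePoint (a + ℓ)}) ?_
      rintro _ ⟨⟨t, ht, rfl⟩, hnot⟩
      by_contra hcon
      simp only [mem_insert_iff, mem_singleton_iff, not_or] at hcon
      refine hnot (h1 ⟨t, ⟨lt_of_le_of_ne ht.1 ?_, lt_of_le_of_ne ht.2 ?_⟩, rfl⟩)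
      · rintro rfl; exact hcon.1 rfl
      · rintro rfl; exact hcon.2 rfl
    have : I = circlePoint '' Icc a (a + ℓ) \ (circlePoint '' Icc a (a + ℓ) \ I) := by
      rw [Set.sdiff_sdiff_right_self]
      exact (inter_eq_right.2 h2).symm
    rw [this]
    exact hJ.diff hfin.measurableSet
  have hm : Measurable fun z : ℂ => z / (‖z‖ : ℂ) := by fun_prop
  have : carlesonSquare I ℓ =
      disc ∩ ({0}ᶜ ∩ ((fun z : ℂ => z / (‖z‖ : ℂ)) ⁻¹' I ∩ {z | 1 - ‖z‖ < ℓ})) := by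
    ext z; rfl
  rw [this]
  exact measurableSet_disc.inter ((measurableSet_singleton 0).compl.inter
    ((hm hIm).inter (measurableSet_lt (by fun_prop) measurable_const)))

theorem carlesonSquare_subset_disc (I : Set ℂ) (ℓ : ℝ) : carlesonSquare I ℓ ⊆ disc :=
  fun _ hz => hz.1

/-- Centre the disc at the midpoint of the arc: the radial distance is below ℓ, the angular one at
most π ℓ ≤ 4 ℓ. -/
theorem exists_carlesonSquare_subset_ball {I : Set ℂ} {ℓ : ℝ} (hI : IsArc I ℓ) :
    ∃ c : ℂ, ‖c‖ = 1 ∧ carlesonSquare I ℓ ⊆ Metric.ball c (5 * ℓ) := by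
  obtain ⟨hℓ, -, a, -, h2⟩ := hI
  refine ⟨circlePoint (a + ℓ / 2), norm_circlePoint _, fun z hz => ?_⟩
  obtain ⟨hzd, hz0, hzI, hzℓ⟩ := hz
  obtain ⟨θ, hθ, hθz⟩ := h2 hzI
  simp only [disc, Metric.mem_ball, dist_zero_right] at hzd
  rw [Metric.mem_ball, dist_eq_norm]
  have hn : ‖z‖ ≠ 0 := norm_ne_zero_iff.2 hz0
  have h3 : ‖z - circlePoint θ‖ = 1 - ‖z‖ := by
    have : z - circlePoint θ = circlePoint θ * ((‖z‖ - 1 : ℝ) : ℂ) := by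
      rw [hθz]
      have : (‖z‖ : ℂ) ≠ 0 := by exact_mod_cast hn
      push_cast
      field_simp
    rw [this, norm_mul, norm_circlePoint, one_mul, Complex.norm_real, Real.norm_eq_abs,
      abs_of_neg (by linarith)]
    ring
  have h4 := norm_circlePoint_sub_le θ (a + ℓ / 2)
  have h5 : |θ - (a + ℓ / 2)| ≤ ℓ / 2 := by
    rw [abs_le]; constructor <;> linarith [hθ.1, hθ.2]
  have h6 : 2 * Real.pi * |θ - (a + ℓ / 2)| ≤ 2 * 4 * (ℓ / 2) := by
    gcongr; exact Real.pi_le_four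
  linarith [norm_sub_le_norm_sub_add_norm_sub z (circlePoint θ) (circlePoint (a + ℓ / 2))]

/-- The square contains a disc of radius ℓ / 4 at height ℓ / 2 below the midpoint of the arc, and (5
ℓ)² = 400 (ℓ/4)². -/
theorem ofReal_sq_le_volume_carlesonSquare {I : Set ℂ} {ℓ : ℝ} (hI : IsArc I ℓ) :
    ENNReal.ofReal ((5 * ℓ) ^ 2) ≤ 400 * volume (carlesonSquare I ℓ) := by
  obtain ⟨hℓ, hℓ1, a, h1, -⟩ := hI
  set c := circlePoint (a + ℓ / 2) with hc
  have hsub : Metric.ball (((1 - ℓ / 2 : ℝ) : ℂ) * c) (ℓ / 4) ⊆ carlesonSquare I ℓ := by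
    intro z hz
    rw [Metric.mem_ball, dist_eq_norm] at hz
    obtain ⟨hz0, θ, hθ, hzθ⟩ := exists_div_norm_eq_circlePoint (z := z) (x := 1 - ℓ / 2)
      (t := a + ℓ / 2) (by linarith) (by linarith)
    have h2 : ‖((1 - ℓ / 2 : ℝ) : ℂ) * c‖ = 1 - ℓ / 2 := by
      rw [norm_mul, hc, norm_circlePoint, Complex.norm_real, Real.norm_of_nonneg (by linarith),
        mul_one]
    have h3 := norm_sub_norm_le z (((1 - ℓ / 2 : ℝ) : ℂ) * c)
    have h4 := norm_sub_norm_le (((1 - ℓ / 2 : ℝ) : ℂ) * c) z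
    rw [norm_sub_rev] at h4
    have h5 := abs_le.1 (hθ.trans hz.le)
    refine ⟨?_, hz0, ?_, by linarith⟩
    · rw [disc, Metric.mem_ball, dist_zero_right]; linarith
    · rw [hzθ]
      exact h1 ⟨θ, ⟨by linarith [h5.1], by linarith [h5.2]⟩, rfl⟩
  have h5 := measure_mono (μ := volume) hsub
  rw [Complex.volume_ball] at h5
  refine le_trans ?_ (mul_le_mul_right h5 400)
  have h6 : (1 : ℝ≥0∞) ≤ NNReal.pi := by
    exact_mod_cast (show (1 : ℝ) ≤ Real.pi by linarith [Real.pi_gt_three])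
  calc ENNReal.ofReal ((5 * ℓ) ^ 2) = 400 * (ENNReal.ofReal (ℓ / 4) ^ 2 * 1) := by
        rw [mul_one, ← ENNReal.ofReal_pow (by positivity), ← ENNReal.ofReal_ofNat 400,
          ← ENNReal.ofReal_mul (by norm_num)]
        congr 1; ring
    _ ≤ _ := by gcongr

theorem volume_carlesonSquare_le {I : Set ℂ} {ℓ : ℝ} (hI : IsArc I ℓ) :
    volume (carlesonSquare I ℓ) ≤ ENNReal.ofReal (100 * ℓ ^ 2) := by
  obtain ⟨c, -, hc⟩ := exists_carlesonSquare_subset_ball hI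
  refine (measure_mono hc).trans ?_
  have h6 : (NNReal.pi : ℝ≥0∞) ≤ 4 := by
    exact_mod_cast Real.pi_le_four
  rw [Complex.volume_ball]
  calc _ ≤ ENNReal.ofReal (5 * ℓ) ^ 2 * 4 := by gcongr
    _ = _ := by
      have := hI.1
      rw [← ENNReal.ofReal_pow (by positivity), ← ENNReal.ofReal_ofNat 4,
          ← ENNReal.ofReal_mul (by positivity)]
      congr 1; ring

theorem volume_carlesonSquare_ne_zero {I : Set ℂ} {ℓ : ℝ} (hI : IsArc I ℓ) :
    volume (carlesonSquare I ℓ) ≠ 0 := by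
  intro h
  have h1 := ofReal_sq_le_volume_carlesonSquare hI
  rw [h, mul_zero, nonpos_iff_eq_zero, ENNReal.ofReal_eq_zero] at h1
  have := hI.1
  have : 0 < (5 * ℓ) ^ 2 := by positivity
  linarith

theorem volume_carlesonSquare_ne_top {I : Set ℂ} {ℓ : ℝ} (hI : IsArc I ℓ) :
    volume (carlesonSquare I ℓ) ≠ ∞ :=
  ne_top_of_le_ne_top ENNReal.ofReal_ne_top (volume_carlesonSquare_le hI)

theorem squareAverage_eq (w : ℂ → ℝ) (I : Set ℂ) (ℓ : ℝ) : squareAverage w I ℓ =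
    (∫⁻ z in carlesonSquare I ℓ, ENNReal.ofReal (w z)) / volume (carlesonSquare I ℓ) := by
  rw [squareAverage, laverage_eq, Measure.restrict_apply_univ]

/-- For r ≥ 1/4 the whole circle serves; otherwise directions deviate by at most r, within half the
arc length 2 r. The origin is added because no Carleson square contains it. -/
theorem exists_ball_subset_carlesonSquare {c : ℂ} (hc : ‖c‖ = 1) {r : ℝ} (hr : 0 < r) :
    ∃ (I : Set ℂ) (ℓ : ℝ), IsArc I ℓ ∧ ℓ ≤ 4 * r ∧
      Metric.ball c r ∩ disc ⊆ insert 0 (carlesonSquare I ℓ) := by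
  obtain ⟨t, -, rfl⟩ := exists_circlePoint_eq hc 0
  set ℓ := min 1 (4 * r)
  set a := t - ℓ / 2 with ha
  refine ⟨circlePoint '' Icc a (a + ℓ), ℓ, ⟨by positivity, min_le_left _ _, a,
    image_mono Ioo_subset_Icc_self, Subset.rfl⟩, min_le_right _ _, ?_⟩
  rintro z ⟨hzr, hzd⟩
  rcases eq_or_ne z 0 with hz0 | hz0
  · exact Or.inl hz0
  refine Or.inr ⟨hzd, hz0, ?_⟩
  rcases le_total (1 / 4) r with h | h
  · have hℓ1 : ℓ = 1 := min_eq_left (by linarith)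
    rw [hℓ1]
    constructor
    · exact exists_circlePoint_eq (by simp [hz0]) a
    · linarith [norm_pos_iff.2 hz0]
  · have hℓr : ℓ = 4 * r := min_eq_right (by linarith)
    rw [Metric.mem_ball, dist_eq_norm] at hzr
    obtain ⟨-, θ, hθ, hzθ⟩ := exists_div_norm_eq_circlePoint (z := z) (x := 1)
      (t := t) (by norm_num) (by rw [Complex.ofReal_one, one_mul]; linarith)
    rw [Complex.ofReal_one, one_mul] at hθ
    have h5 := abs_le.1 (hθ.trans hzr.le)
    constructor
    · rw [hzθ]
      exact ⟨θ, ⟨by linarith [h5.1], by linarith [h5.2]⟩, rfl⟩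
    · have h3 := norm_sub_norm_le (circlePoint t) z
      rw [norm_circlePoint, norm_sub_rev] at h3
      linarith

theorem maximalFunction_le_ballMaximal (w : ℂ → ℝ) (z : ℂ) :
    maximalFunction w z ≤ 400 * ballMaximal (fun y => ENNReal.ofReal (w y)) z := by
  refine iSup_le fun I => iSup_le fun ℓ => iSup_le fun hI => iSup_le fun hz => ?_
  obtain ⟨c, hc, hsub⟩ := exists_carlesonSquare_subset_ball hI
  have hℓ := hI.1
  have h1 := average_le_ballMaximal (fun y => ENNReal.ofReal (w y)) hc
    (by positivity : 0 < 5 * ℓ) (hsub hz)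
  refine le_trans ?_ (mul_le_mul_right h1 400)
  have hS0 := volume_carlesonSquare_ne_zero hI
  have hSt := volume_carlesonSquare_ne_top hI
  have ha0 : ENNReal.ofReal ((5 * ℓ) ^ 2) ≠ 0 := by
    simpa using hℓ.ne'
  rw [squareAverage_eq, ← mul_div_assoc, ENNReal.le_div_iff_mul_le (Or.inl ha0)
    (Or.inl ENNReal.ofReal_ne_top)]
  have h2 : ∫⁻ y in carlesonSquare I ℓ, ENNReal.ofReal (w y) ≤
      ∫⁻ y in Metric.ball c (5 * ℓ), ENNReal.ofReal (w y) ∂discMeasure := by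
    rw [Measure.restrict_restrict Metric.isOpen_ball.measurableSet]
    exact lintegral_mono_set (subset_inter hsub (carlesonSquare_subset_disc I ℓ))
  calc _ ≤ (∫⁻ y in Metric.ball c (5 * ℓ), ENNReal.ofReal (w y) ∂discMeasure) /
        volume (carlesonSquare I ℓ) * (400 * volume (carlesonSquare I ℓ)) := by
        gcongr
        exact ofReal_sq_le_volume_carlesonSquare hI
    _ = _ := by
        rw [mul_left_comm, ENNReal.div_mul_cancel hS0 hSt]

theorem lintegral_ball_le_squareAverage (w : ℂ → ℝ) {c : ℂ} {r ℓ : ℝ} {I : Set ℂ} (hI : IsArc I ℓ)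
    (hℓr : ℓ ≤ 4 * r) (hsub : Metric.ball c r ∩ disc ⊆ insert 0 (carlesonSquare I ℓ)) :
    ∫⁻ y in Metric.ball c r, ENNReal.ofReal (w y) ∂discMeasure ≤
      1600 * ENNReal.ofReal (r ^ 2) * squareAverage w I ℓ := by
  have hℓ := hI.1
  have hS0 := volume_carlesonSquare_ne_zero hI
  have hSt := volume_carlesonSquare_ne_top hI
  calc _ ≤ ∫⁻ y in insert 0 (carlesonSquare I ℓ), ENNReal.ofReal (w y) := by
        rw [Measure.restrict_restrict Metric.isOpen_ball.measurableSet]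
        exact lintegral_mono_set hsub
    _ = ∫⁻ y in carlesonSquare I ℓ, ENNReal.ofReal (w y) := by
        rw [Measure.restrict_congr_set (insert_ae_eq_self 0 _)]
    _ = volume (carlesonSquare I ℓ) * squareAverage w I ℓ := by
        rw [squareAverage_eq, ENNReal.mul_div_cancel hS0 hSt]
    _ ≤ _ := by
        gcongr
        refine (volume_carlesonSquare_le hI).trans ?_
        rw [← ENNReal.ofReal_ofNat 1600, ← ENNReal.ofReal_mul (by norm_num)]
        apply ENNReal.ofReal_le_ofReal
        nlinarith

/-! ### Weights as densities, and `B_p` transferred to discs. -/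

open Classical in
/-- A weight as an `ℝ≥0∞`-valued function on the plane, with the value `1` off the disc. -/
def weightDensity (w : ℂ → ℝ) (z : ℂ) : ℝ≥0∞ := if z ∈ disc then ENNReal.ofReal (w z) else 1

theorem weightDensity_of_mem (w : ℂ → ℝ) {z : ℂ} (hz : z ∈ disc) :
    weightDensity w z = ENNReal.ofReal (w z) := if_pos hz

theorem IsWeight.measurable_weightDensity {w : ℂ → ℝ} (hw : IsWeight w) :
    Measurable (weightDensity w) := by
  refine measurable_of_restrict_of_restrict_compl measurableSet_disc ?_ ?_
  · have : disc.domRestrict (weightDensity w) =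
        fun z => ENNReal.ofReal (disc.domRestrict w z) := by
      ext z
      exact weightDensity_of_mem w z.2
    rw [this]
    exact ENNReal.measurable_ofReal.comp hw.measurable
  · have : discᶜ.domRestrict (weightDensity w) = fun _ => 1 := by
      ext z
      exact if_neg z.2
    rw [this]
    exact measurable_const

theorem weightDensity_ae_eq (w : ℂ → ℝ) :
    weightDensity w =ᵐ[discMeasure] fun z => ENNReal.ofReal (w z) := by
  filter_upwards [ae_restrict_mem measurableSet_disc] with z hz
  exact weightDensity_of_mem w hz

/-- Each disc is covered, up to the origin, by a square of comparable area. The value 1 off the disc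
keeps the density nonzero and finite everywhere, as `IsBallBp` demands. -/
theorem MemBp.isBallBp {p : ℝ} (hp : 1 < p) {w : ℂ → ℝ} (hw : IsWeight w) (h : MemBp p w) :
    ∃ K, IsBallBp (p - 1) (weightDensity w) K := by
  have hs : 0 < p - 1 := by linarith
  have hs1 : 0 < p - 1 + 1 := by linarith
  refine ⟨1600 ^ (p - 1 + 1) * bpConstant p w, hw.measurable_weightDensity, fun z => ?_,
    fun z => ?_, ENNReal.mul_ne_top (ENNReal.rpow_ne_top_of_nonneg hs1.le (by simp)) h.ne,
    fun c r hc hr => ?_⟩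
  · rw [weightDensity]
    split_ifs with hz
    · simpa using hw.pos z hz
    · exact one_ne_zero
  · rw [weightDensity]
    split_ifs
    · exact ENNReal.ofReal_ne_top
    · exact ENNReal.one_ne_top
  obtain ⟨I, ℓ, hI, hℓr, hsub⟩ := exists_ball_subset_carlesonSquare hc hr
  have h1 : ∫⁻ y in Metric.ball c r, weightDensity w y ∂discMeasure =
      ∫⁻ y in Metric.ball c r, ENNReal.ofReal (w y) ∂discMeasure :=
    lintegral_congr_ae (ae_restrict_of_ae (weightDensity_ae_eq w))
  have h2 : ∫⁻ y in Metric.ball c r, weightDensity w y ^ (-(1 / (p - 1))) ∂discMeasure =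
      ∫⁻ y in Metric.ball c r, ENNReal.ofReal (w y ^ (-(1 / (p - 1)))) ∂discMeasure := by
    refine lintegral_congr_ae (ae_restrict_of_ae ?_)
    filter_upwards [ae_restrict_mem measurableSet_disc] with z hz
    rw [weightDensity_of_mem w hz, ENNReal.ofReal_rpow_of_pos (hw.pos z hz)]
  have h3 := lintegral_ball_le_squareAverage w hI hℓr hsub
  have h4 := lintegral_ball_le_squareAverage (fun z => w z ^ (-(1 / (p - 1)))) hI hℓr hsub
  have h5 : squareAverage w I ℓ * squareAverage (fun z => w z ^ (-(1 / (p - 1)))) I ℓ ^ (p - 1) ≤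
      bpConstant p w := le_iSup_of_le I (le_iSup_of_le ℓ (le_iSup_of_le hI le_rfl))
  rw [h1, h2]
  set a := ENNReal.ofReal (r ^ 2)
  set A := squareAverage w I ℓ
  set B := squareAverage (fun z => w z ^ (-(1 / (p - 1)))) I ℓ
  calc _ ≤ (1600 * a * A) * (1600 * a * B) ^ (p - 1) := by gcongr
    _ = (1600 * a) ^ (1 + (p - 1)) * (A * B ^ (p - 1)) := by
        rw [ENNReal.mul_rpow_of_nonneg _ _ hs.le,
          ENNReal.rpow_add_of_nonneg _ _ zero_le_one hs.le, ENNReal.rpow_one]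
        ring
    _ ≤ (1600 * a) ^ (1 + (p - 1)) * bpConstant p w := by gcongr
    _ = _ := by
        rw [add_comm 1, ENNReal.mul_rpow_of_nonneg _ _ hs1.le]
        ring

/-! ### Hyperbolic oscillation and smoothing. -/

theorem pseudoHyperbolicDist_comm (z ζ : ℂ) :
    pseudoHyperbolicDist z ζ = pseudoHyperbolicDist ζ z := by
  have h : 1 - (starRingEnd ℂ) z * ζ = (starRingEnd ℂ) (1 - (starRingEnd ℂ) ζ * z) := by
    simp [mul_comm]
  rw [pseudoHyperbolicDist, pseudoHyperbolicDist, norm_div, norm_div, h, RCLike.norm_conj,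
    norm_sub_rev]

theorem hyperbolicDist_comm (z ζ : ℂ) : hyperbolicDist z ζ = hyperbolicDist ζ z := by
  rw [hyperbolicDist, hyperbolicDist, pseudoHyperbolicDist_comm]

theorem hyperbolicDist_le_one {z ζ : ℂ} (hz : z ∈ disc) (hζ : ζ ∈ disc)
    (h : ‖ζ - z‖ ≤ (1 - ‖z‖) / 2) : hyperbolicDist z ζ ≤ 1 := by
  simp only [disc, Metric.mem_ball, dist_zero_right] at hz hζ
  have hd : 1 - ‖z‖ ≤ ‖1 - (starRingEnd ℂ) ζ * z‖ := by
    have h1 := norm_sub_norm_le (1 : ℂ) ((starRingEnd ℂ) ζ * z)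
    rw [norm_one, norm_mul, RCLike.norm_conj] at h1
    nlinarith [norm_nonneg ζ, norm_nonneg z]
  have hρ : pseudoHyperbolicDist z ζ ≤ 1 / 2 := by
    rw [pseudoHyperbolicDist, norm_div, div_le_iff₀ (by linarith)]
    linarith
  have hρ0 : 0 ≤ pseudoHyperbolicDist z ζ := norm_nonneg _
  have h3 : (1 + pseudoHyperbolicDist z ζ) / (1 - pseudoHyperbolicDist z ζ) ≤ 3 := by
    rw [div_le_iff₀ (by linarith)]
    linarith
  have h4 := Real.log_le_sub_one_of_pos (show (0 : ℝ) < 3 by norm_num)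
  have h5 := Real.log_le_log (div_pos (by linarith) (by linarith)) h3
  rw [hyperbolicDist]
  linarith

/-- Finiteness of u at one point gives finiteness of its maximal function there, and slow variation
carries it to the whole disc. -/
theorem ballMaximal_ne_top {u : ℂ → ℝ≥0∞} {C : ℝ≥0∞} (hC : C ≠ ∞)
    (hu : ∀ᵐ z ∂discMeasure, u z ≠ ∞) (h : ∀ z, ballMaximal u z ≤ C * u z) {z : ℂ}
    (hz : z ∈ disc) : ballMaximal u z ≠ ∞ := by
  have : (ae discMeasure).NeBot := by
    rw [ae_neBot, Ne, Measure.restrict_eq_zero]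
    exact (Metric.measure_ball_pos volume 0 one_pos).ne'
  obtain ⟨ζ, hζ⟩ := hu.exists
  exact ne_top_of_le_ne_top (ENNReal.mul_ne_top ENNReal.ofReal_ne_top
    (ne_top_of_le_ne_top (ENNReal.mul_ne_top hC hζ) (h ζ))) (ballMaximal_le_mul_ballMaximal u hz ζ)

theorem ballMaximal_ne_zero {u : ℂ → ℝ≥0∞} (hu : ∀ z, 1 ≤ u z) {z : ℂ} (hz : z ∈ disc) :
    ballMaximal u z ≠ 0 := by
  intro h
  have h1 := average_le_ballMaximal u (c := 1) (r := 2) (by simp) two_pos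
    (disc_subset_ball (by simp) le_rfl hz)
  rw [h, nonpos_iff_eq_zero, ENNReal.div_eq_zero_iff] at h1
  refine h1.elim (fun h2 => ?_) ENNReal.ofReal_ne_top
  refine discMeasure_ball_pos (c := 1) (by simp) two_pos le_rfl ?_
  rw [← nonpos_iff_eq_zero, ← h2]
  calc _ = ∫⁻ y in Metric.ball 1 2, 1 ∂discMeasure := by rw [setLIntegral_const, one_mul]
    _ ≤ _ := lintegral_mono hu

/-- Finite positive maximal functions are of bounded hyperbolic oscillation. -/
theorem abs_log_ballMaximal_sub_le {u : ℂ → ℝ≥0∞} (h0 : ∀ z ∈ disc, ballMaximal u z ≠ 0)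
    (ht : ∀ z ∈ disc, ballMaximal u z ≠ ∞) {z ζ : ℂ} (hz : z ∈ disc) (hζ : ζ ∈ disc) :
    |Real.log (ballMaximal u z).toReal - Real.log (ballMaximal u ζ).toReal| ≤
      4 * (1 + hyperbolicDist z ζ) := by
  have key : ∀ z ∈ disc, ∀ ζ ∈ disc, Real.log (ballMaximal u z).toReal -
      Real.log (ballMaximal u ζ).toReal ≤ 4 * (1 + hyperbolicDist z ζ) := by
    intro z hz ζ hζ
    have hz1 : 0 < 1 - ‖z‖ := by
      simp only [disc, Metric.mem_ball, dist_zero_right] at hz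
      linarith
    have hpos : 0 < 1 + ‖ζ - z‖ / (1 - ‖z‖) := by positivity
    have h1 := ENNReal.toReal_mono (ENNReal.mul_ne_top ENNReal.ofReal_ne_top (ht ζ hζ))
      (ballMaximal_le_mul_ballMaximal u hz ζ)
    rw [ENNReal.toReal_mul, ENNReal.toReal_ofReal (by positivity)] at h1
    have h2 := Real.log_le_log (ENNReal.toReal_pos (h0 z hz) (ht z hz)) h1
    rw [Real.log_mul (by positivity) (ENNReal.toReal_pos (h0 ζ hζ) (ht ζ hζ)).ne',
      Real.log_pow] at h2
    -- The squared factor doubles this bound, and log 5 ≤ 2 leaves 4 + 4 β.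
    have h3 := log_one_add_le_hyperbolicDist hz hζ
    have h4 : Real.log 5 ≤ 2 := by
      rw [Real.log_le_iff_le_exp (by norm_num)]
      have h5 := Real.exp_one_gt_d9
      have h6 : Real.exp 2 = Real.exp 1 * Real.exp 1 := by rw [← Real.exp_add]; norm_num
      rw [h6]
      nlinarith
    push_cast at h2
    linarith
  rw [abs_le]
  constructor
  · have := key ζ hζ z hz
    rw [hyperbolicDist_comm] at this
    linarith
  · exact key z hz ζ hζ

theorem exists_norm_eq_one_norm_sub {z : ℂ} (hz : z ∈ disc) :
    ∃ c : ℂ, ‖c‖ = 1 ∧ ‖z - c‖ = 1 - ‖z‖ := by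
  rcases eq_or_ne z 0 with rfl | hz0
  · exact ⟨1, by simp, by simp⟩
  · simp only [disc, Metric.mem_ball, dist_zero_right] at hz
    have hn : (‖z‖ : ℂ) ≠ 0 := by simpa using hz0
    refine ⟨z / ‖z‖, by simp [hz0], ?_⟩
    have h1 : z - z / ‖z‖ = z / ‖z‖ * ((‖z‖ - 1 : ℝ) : ℂ) := by
      push_cast
      field_simp
    have h2 : ‖z / (‖z‖ : ℂ)‖ = 1 := by simp [hz0]
    rw [h1, norm_mul, h2, one_mul, Complex.norm_real, Real.norm_eq_abs, abs_of_neg (by linarith)]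
    ring

/-- With d = 1 - |z|, the disc of radius 2 d about a nearest boundary point contains the one of
radius d / 2 about z; the squared ratio of radii is 16. -/
theorem le_ballMaximal_of_le_on_ball {u : ℂ → ℝ≥0∞} {z : ℂ} (hz : z ∈ disc) {A : ℝ≥0∞}
    (h : ∀ᵐ ζ ∂discMeasure, ‖ζ - z‖ < (1 - ‖z‖) / 2 → A ≤ u ζ) : A ≤ 16 * ballMaximal u z := by
  obtain ⟨c, hc, hcz⟩ := exists_norm_eq_one_norm_sub hz
  have hz1 : 0 < 1 - ‖z‖ := by
    simp only [disc, Metric.mem_ball, dist_zero_right] at hz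
    linarith
  set d := 1 - ‖z‖
  have h1 := average_le_ballMaximal u hc (by positivity : 0 < 2 * d)
    (z := z) (by rw [Metric.mem_ball, dist_eq_norm]; linarith)
  have hsub : Metric.ball z (d / 2) ⊆ Metric.ball c (2 * d) ∩ disc := by
    intro ζ hζ
    rw [Metric.mem_ball, dist_eq_norm] at hζ
    refine ⟨?_, ?_⟩
    · rw [Metric.mem_ball, dist_eq_norm]
      linarith [norm_sub_le_norm_sub_add_norm_sub ζ z c]
    · rw [disc, Metric.mem_ball, dist_zero_right]
      linarith [norm_sub_norm_le ζ z]
  have hvol : ENNReal.ofReal ((2 * d) ^ 2) ≤ 16 * volume (Metric.ball z (d / 2)) := by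
    have h6 : (1 : ℝ≥0∞) ≤ NNReal.pi := by
      exact_mod_cast (show (1 : ℝ) ≤ Real.pi by linarith [Real.pi_gt_three])
    rw [Complex.volume_ball]
    calc _ = 16 * (ENNReal.ofReal (d / 2) ^ 2 * 1) := by
          rw [mul_one, ← ENNReal.ofReal_pow (by positivity), ← ENNReal.ofReal_ofNat 16,
            ← ENNReal.ofReal_mul (by norm_num)]
          congr 1; ring
      _ ≤ _ := by gcongr
  have hv0 : volume (Metric.ball z (d / 2)) ≠ 0 :=
    (Metric.measure_ball_pos volume z (by positivity)).ne'
  have hvt : volume (Metric.ball z (d / 2)) ≠ ∞ := measure_ball_lt_top.ne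
  have ha0 : ENNReal.ofReal ((2 * d) ^ 2) ≠ 0 := by simpa using hz1.ne'
  have h2 : A * volume (Metric.ball z (d / 2)) ≤
      ∫⁻ y in Metric.ball c (2 * d), u y ∂discMeasure := by
    rw [← setLIntegral_const]
    calc ∫⁻ _ in Metric.ball z (d / 2), A ≤ ∫⁻ y in Metric.ball z (d / 2), u y := by
          refine lintegral_mono_ae ?_
          have h3 := ae_restrict_of_ae_restrict_of_subset (hsub.trans inter_subset_right) h
          filter_upwards [h3, ae_restrict_mem Metric.isOpen_ball.measurableSet] with ζ hζ hζ'
          rw [Metric.mem_ball, dist_eq_norm] at hζ'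
          exact hζ hζ'
      _ ≤ _ := by
          rw [Measure.restrict_restrict Metric.isOpen_ball.measurableSet]
          exact lintegral_mono_set hsub
  rw [ENNReal.div_le_iff ha0 ENNReal.ofReal_ne_top] at h1
  refine (ENNReal.mul_le_mul_iff_left hv0 hvt).1 (h2.trans (h1.trans ?_))
  calc _ ≤ ballMaximal u z * (16 * volume (Metric.ball z (d / 2))) := by gcongr
    _ = _ := by ring

/-- Near z both M(W u^s) and w are essentially constant, so the bound at nearby ζ is a lower bound
for u(ζ) by one constant. Averaging over ζ replaces u(ζ) by M u(z). -/
theorem ballMaximal_smoothing_le {s : ℝ} (hs : 0 < s) {w : ℂ → ℝ} (hw : IsWeight w)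
    (hosc : BoundedHyperbolicOscillation w) {u : ℂ → ℝ≥0∞} {C : ℝ≥0∞} (hC : C ≠ ∞)
    (h : ∀ z, ballMaximal (fun y => weightDensity w y * u y ^ s) z ≤
      C * (weightDensity w z * u z ^ s)) :
    ∃ C' : ℝ≥0∞, C' ≠ ∞ ∧ ∀ᵐ z ∂discMeasure,
      ballMaximal (fun y => weightDensity w y * u y ^ s) z ≤
        C' * (ENNReal.ofReal (w z) * ballMaximal u z ^ s) := by
  obtain ⟨L, hL, hae⟩ := hosc
  -- Nearby points are at hyperbolic distance at most 1, so w changes by at most the factor exp(L (1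
  -- + 1)).
  set κ := ENNReal.ofReal (Real.exp (L * 2)) with hκ
  have hκ0 : κ ≠ 0 := by simp [hκ, Real.exp_pos]
  have h16 : (16 : ℝ≥0∞) ^ s ≠ ∞ := ENNReal.rpow_ne_top_of_nonneg hs.le (by simp)
  refine ⟨4 * (C + 1) * κ * 16 ^ s, ?_, ?_⟩
  · exact ENNReal.mul_ne_top (ENNReal.mul_ne_top (ENNReal.mul_ne_top (by simp)
      (ENNReal.add_ne_top.2 ⟨hC, by simp⟩)) ENNReal.ofReal_ne_top) h16
  filter_upwards [Measure.ae_ae_of_ae_prod hae, ae_restrict_mem measurableSet_disc] with z hz hzd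
  have hz1 : 0 < 1 - ‖z‖ := by
    simp only [disc, Metric.mem_ball, dist_zero_right] at hzd
    linarith
  set G : ℂ → ℝ≥0∞ := fun y => weightDensity w y * u y ^ s
  -- Here 4 bounds the variation of the maximal function, and C + 1 replaces C so that B can be
  -- divided by.
  set B : ℝ≥0∞ := 4 * (C + 1) * κ * ENNReal.ofReal (w z) with hB
  have hw0 : ENNReal.ofReal (w z) ≠ 0 := by simpa using hw.pos z hzd
  have hB0 : B ≠ 0 := by
    rw [hB]
    simp [hκ0, hw0]
  have hBt : B ≠ ∞ := ENNReal.mul_ne_top (ENNReal.mul_ne_top (ENNReal.mul_ne_top (by simp)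
      (ENNReal.add_ne_top.2 ⟨hC, by simp⟩)) ENNReal.ofReal_ne_top) ENNReal.ofReal_ne_top
  have hmain : (ballMaximal G z / B) ^ s⁻¹ ≤ 16 * ballMaximal u z := by
    refine le_ballMaximal_of_le_on_ball hzd ?_
    filter_upwards [hz, ae_restrict_mem measurableSet_disc] with ζ hζ hζd hdist
    rw [ENNReal.rpow_inv_le_iff hs, ENNReal.div_le_iff hB0 hBt]
    have h1 : ENNReal.ofReal ((1 + ‖ζ - z‖ / (1 - ‖z‖)) ^ 2) ≤ 4 := by
      rw [← ENNReal.ofReal_ofNat 4]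
      apply ENNReal.ofReal_le_ofReal
      have h2 : ‖ζ - z‖ / (1 - ‖z‖) ≤ 1 := by
        rw [div_le_one hz1]; linarith
      have h3 : 0 ≤ ‖ζ - z‖ / (1 - ‖z‖) := by positivity
      nlinarith
    have h2 : ENNReal.ofReal (w ζ) ≤ κ * ENNReal.ofReal (w z) := by
      rw [hκ, ← ENNReal.ofReal_mul (Real.exp_pos _).le]
      apply ENNReal.ofReal_le_ofReal
      have h3 := hyperbolicDist_le_one hzd hζd hdist.le
      have h4 : Real.log (w ζ) ≤ L * 2 + Real.log (w z) := by
        have h5 := (abs_le.1 hζ).1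
        have h6 : L * (1 + hyperbolicDist z ζ) ≤ L * 2 := by gcongr; linarith
        linarith
      rw [← Real.exp_log (hw.pos z hzd), ← Real.exp_add, ← Real.log_le_iff_le_exp (hw.pos ζ hζd)]
      simpa using h4
    calc ballMaximal G z ≤ _ := ballMaximal_le_mul_ballMaximal G hzd ζ
      _ ≤ 4 * (C * (weightDensity w ζ * u ζ ^ s)) := by gcongr; exact h ζ
      _ ≤ 4 * ((C + 1) * ((κ * ENNReal.ofReal (w z)) * u ζ ^ s)) := by
          rw [weightDensity_of_mem w hζd]
          gcongr
          exact le_self_add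
      _ = u ζ ^ s * B := by rw [hB]; ring
  rw [ENNReal.rpow_inv_le_iff hs, ENNReal.div_le_iff hB0 hBt,
    ENNReal.mul_rpow_of_nonneg _ _ hs.le] at hmain
  refine hmain.trans (le_of_eq ?_)
  rw [hB]; ring

/-! ### The two directions of the equivalence. -/

theorem exists_factorization_of_memBp {p : ℝ} (hp : 1 < p) {w : ℂ → ℝ} (hw : IsWeight w)
    (hosc : BoundedHyperbolicOscillation w) (h : MemBp p w) :
    ∃ w₁ w₂ : ℂ → ℝ,
        (IsWeight w₁ ∧ MemB1 w₁ ∧ BoundedHyperbolicOscillation w₁) ∧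
        (IsWeight w₂ ∧ MemB1 w₂ ∧ BoundedHyperbolicOscillation w₂) ∧
        ∀ z ∈ disc, w z = w₁ z * w₂ z ^ (1 - p) := by
  have hs : 0 < p - 1 := by linarith
  obtain ⟨K, hK⟩ := h.isBallBp hp hw
  obtain ⟨u, C, hC, hum, hu1, hut, hMu, hMG⟩ := hK.exists_factorization hs
  obtain ⟨C', hC', hsm⟩ := ballMaximal_smoothing_le hs hw hosc hC hMG
  set s := p - 1 with hsdef
  set v := ballMaximal u with hv
  have hvm : Measurable v := measurable_ballMaximal u
  have hv0 : ∀ z ∈ disc, v z ≠ 0 := fun z hz => ballMaximal_ne_zero hu1 hz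
  have hvt : ∀ z ∈ disc, v z ≠ ∞ := fun z hz => ballMaximal_ne_top hC hut hMu hz
  have hvpos : ∀ z ∈ disc, 0 < (v z).toReal := fun z hz =>
    ENNReal.toReal_pos (hv0 z hz) (hvt z hz)
  have hprod : ∀ᵐ q ∂discMeasure.prod discMeasure, q.1 ∈ disc ∧ q.2 ∈ disc := by
    rw [Measure.prod_restrict]
    exact ae_restrict_mem (measurableSet_disc.prod measurableSet_disc)
  have hw₁ : IsWeight fun z => w z * (v z).toReal ^ s := by
    refine ⟨?_, fun z hz => mul_pos (hw.pos z hz) (Real.rpow_pos_of_pos (hvpos z hz) _)⟩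
    exact hw.measurable.mul ((hvm.ennreal_toReal.pow_const s).comp measurable_subtype_coe)
  have hw₂ : IsWeight fun z => (v z).toReal :=
    ⟨hvm.ennreal_toReal.comp measurable_subtype_coe, hvpos⟩
  have hosc₂ : ∀ z ∈ disc, ∀ ζ ∈ disc, |Real.log (v z).toReal - Real.log (v ζ).toReal| ≤
      4 * (1 + hyperbolicDist z ζ) := fun z hz ζ hζ => abs_log_ballMaximal_sub_le hv0 hvt hz hζ
  refine ⟨fun z => w z * (v z).toReal ^ s, fun z => (v z).toReal, ⟨hw₁, ?_, ?_⟩, ⟨hw₂, ?_, ?_⟩,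
    fun z hz => ?_⟩
  · have hCs : C ^ s ≠ ∞ := ENNReal.rpow_ne_top_of_nonneg hs.le hC
    refine ⟨(400 * (C ^ s * C')).toNNReal, ?_⟩
    filter_upwards [hsm, ae_restrict_mem measurableSet_disc] with z hz hzd
    rw [ENNReal.coe_toNNReal (ENNReal.mul_ne_top (by simp) (ENNReal.mul_ne_top hCs hC'))]
    refine (maximalFunction_le_ballMaximal _ z).trans ?_
    rw [mul_assoc]
    gcongr
    have h1 : ∀ z ∈ disc, ENNReal.ofReal (w z * (v z).toReal ^ s) =
        ENNReal.ofReal (w z) * v z ^ s := fun z hz => by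
      rw [ENNReal.ofReal_mul (hw.pos z hz).le, ← ENNReal.ofReal_rpow_of_pos (hvpos z hz),
        ENNReal.ofReal_toReal (hvt z hz)]
    -- The bound v ≤ C u passes from v to u inside the maximal function; smoothing then returns to v
    -- outside it.
    calc _ ≤ ballMaximal (fun y => C ^ s * (weightDensity w y * u y ^ s)) z := by
          refine ballMaximal_mono_ae ?_ z
          filter_upwards [ae_restrict_mem measurableSet_disc] with y hy
          rw [h1 y hy, weightDensity_of_mem w hy, mul_left_comm,
            ← ENNReal.mul_rpow_of_nonneg _ _ hs.le]
          gcongr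
          exact hMu y
      _ = C ^ s * ballMaximal (fun y => weightDensity w y * u y ^ s) z :=
          ballMaximal_const_mul hCs _ z
      _ ≤ C ^ s * (C' * (ENNReal.ofReal (w z) * v z ^ s)) := by gcongr
      _ = _ := by rw [h1 z hzd, mul_assoc]
  · obtain ⟨L, hL, hae⟩ := hosc
    refine ⟨L + s * 4, by positivity, ?_⟩
    filter_upwards [hae, hprod] with q hq hqd
    have h1 := hosc₂ q.1 hqd.1 q.2 hqd.2
    have h2 : ∀ z ∈ disc, Real.log (w z * (v z).toReal ^ s) =
        Real.log (w z) + s * Real.log (v z).toReal := fun z hz => by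
      rw [Real.log_mul (hw.pos z hz).ne' (Real.rpow_pos_of_pos (hvpos z hz) _).ne',
        Real.log_rpow (hvpos z hz)]
    rw [h2 _ hqd.1, h2 _ hqd.2]
    rw [abs_le] at h1 hq ⊢
    constructor
    · nlinarith [mul_le_mul_of_nonneg_left h1.1 hs.le]
    · nlinarith [mul_le_mul_of_nonneg_left h1.2 hs.le]
  · refine ⟨(400 * C).toNNReal, ?_⟩
    filter_upwards [ae_restrict_mem measurableSet_disc] with z hz
    rw [ENNReal.coe_toNNReal (ENNReal.mul_ne_top (by simp) hC),
      ENNReal.ofReal_toReal (hvt z hz), mul_assoc]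
    refine (maximalFunction_le_ballMaximal _ z).trans ?_
    gcongr
    rw [hv, ← ballMaximal_const_mul hC]
    exact ballMaximal_mono_ae (ae_of_all _ fun y => ENNReal.ofReal_toReal_le.trans (hMu y)) z
  · refine ⟨4, by norm_num, ?_⟩
    filter_upwards [hprod] with q hq
    exact hosc₂ q.1 hq.1 q.2 hq.2
  · rw [mul_assoc, ← Real.rpow_add (hvpos z hz)]
    simp [hsdef]

theorem memBp_of_factorization {p : ℝ} (hp : 1 < p) {w w₁ w₂ : ℂ → ℝ} (hw₁ : IsWeight w₁)
    (hw₂ : IsWeight w₂) (h₁ : MemB1 w₁) (h₂ : MemB1 w₂)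
    (hw : ∀ z ∈ disc, w z = w₁ z * w₂ z ^ (1 - p)) : MemBp p w := by
  have hs : 0 < p - 1 := by linarith
  obtain ⟨C₁, h₁⟩ := h₁
  obtain ⟨C₂, h₂⟩ := h₂
  refine lt_of_le_of_lt ?_ (ENNReal.mul_lt_top (ENNReal.coe_lt_top (r := C₁))
    (ENNReal.rpow_lt_top_of_nonneg hs.le (ENNReal.coe_ne_top (r := C₂))))
  refine iSup_le fun I => iSup_le fun ℓ => iSup_le fun hI => ?_
  have hSm := measurableSet_carlesonSquare hI
  have hS0 := volume_carlesonSquare_ne_zero hI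
  have hSt := volume_carlesonSquare_ne_top hI
  have hSd := carlesonSquare_subset_disc I ℓ
  set S := carlesonSquare I ℓ
  have hle : ∀ (v : ℂ → ℝ) (C : ℝ≥0), (∀ᵐ z ∂(volume.restrict disc),
      maximalFunction v z ≤ (C : ℝ≥0∞) * ENNReal.ofReal (v z)) →
      ∀ᵐ z ∂(volume.restrict S), squareAverage v I ℓ ≤ C * ENNReal.ofReal (v z) := by
    intro v C h
    filter_upwards [ae_restrict_of_ae_restrict_of_subset hSd h, ae_restrict_mem hSm] with z hz hzS
    exact le_trans (le_iSup_of_le I (le_iSup_of_le ℓ (le_iSup_of_le hI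
      (le_iSup (fun _ : z ∈ carlesonSquare I ℓ => squareAverage v I ℓ) hzS)))) hz
  have hne : (ae (volume.restrict S)).NeBot := by
    rw [ae_neBot, Ne, Measure.restrict_eq_zero]
    exact hS0
  -- The `B_1` bound at a single point of the square already makes the average finite, so it can be
  -- cancelled at the end.
  have htop : ∀ (v : ℂ → ℝ) (C : ℝ≥0), (∀ᵐ z ∂(volume.restrict S),
      squareAverage v I ℓ ≤ C * ENNReal.ofReal (v z)) → squareAverage v I ℓ ≠ ∞ := by
    intro v C h
    obtain ⟨z, hz⟩ := h.exists
    exact ne_top_of_le_ne_top (ENNReal.mul_ne_top ENNReal.coe_ne_top ENNReal.ofReal_ne_top) hz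
  have hzero : ∀ v : ℂ → ℝ, IsWeight v → squareAverage v I ℓ ≠ 0 := by
    intro v hv h
    rw [squareAverage_eq, ENNReal.div_eq_zero_iff] at h
    have h2 := h.resolve_right hSt
    have h3 : ∫⁻ z in S, weightDensity v z = 0 := by
      rw [← h2]
      exact setLIntegral_congr_fun hSm fun z hz => weightDensity_of_mem v (hSd hz)
    rw [lintegral_eq_zero_iff hv.measurable_weightDensity] at h3
    obtain ⟨z, hz, hzS⟩ := (h3.and (ae_restrict_mem hSm)).exists
    rw [weightDensity_of_mem v (hSd hzS)] at hz
    simp only [Pi.zero_apply, ENNReal.ofReal_eq_zero] at hz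
    exact absurd (hv.pos z (hSd hzS)) (not_lt.2 hz)
  have hmono : ∀ (f g : ℂ → ℝ) (c : ℝ≥0∞), c ≠ ∞ → (∀ᵐ z ∂(volume.restrict S),
      ENNReal.ofReal (f z) ≤ c * ENNReal.ofReal (g z)) →
      squareAverage f I ℓ ≤ c * squareAverage g I ℓ := by
    intro f g c hc h
    rw [squareAverage_eq, squareAverage_eq, ← mul_div_assoc, ← lintegral_const_mul' _ _ hc]
    gcongr ?_ / _
    exact lintegral_mono_ae h
  have h₁' := hle w₁ C₁ h₁
  have h₂' := hle w₂ C₂ h₂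
  have ht₁ := htop w₁ C₁ h₁'
  have ht₂ := htop w₂ C₂ h₂'
  have hz₁ := hzero w₁ hw₁
  have hz₂ := hzero w₂ hw₂
  set A₁ := squareAverage w₁ I ℓ
  set A₂ := squareAverage w₂ I ℓ
  -- The lower bound A / C for a `B_1` weight becomes an upper bound for its negative powers, which
  -- can then be pulled out of the averages.
  have hneg : ∀ (A : ℝ≥0∞) (C : ℝ≥0) (x t : ℝ), A ≠ 0 → A ≠ ∞ → 0 < x → 0 < t →
      A ≤ C * ENNReal.ofReal x → ENNReal.ofReal (x ^ (-t)) ≤ (C / A) ^ t := by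
    intro A C x t hA hAt hx ht h
    rw [← ENNReal.ofReal_rpow_of_pos hx, ENNReal.rpow_neg, ← ENNReal.inv_rpow]
    refine ENNReal.rpow_le_rpow ?_ ht.le
    rw [ENNReal.le_div_iff_mul_le (Or.inl hA) (Or.inl hAt), mul_comm, ← div_eq_mul_inv]
    exact ENNReal.div_le_of_le_mul h
  have hfin : ∀ (A : ℝ≥0∞) (C : ℝ≥0) (t : ℝ), A ≠ 0 → 0 < t → ((C : ℝ≥0∞) / A) ^ t ≠ ∞ :=
    fun A C t hA ht => ENNReal.rpow_ne_top_of_nonneg ht.le (ENNReal.div_ne_top ENNReal.coe_ne_top hA)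
  have e₁ : squareAverage w I ℓ ≤ (C₂ / A₂) ^ (p - 1) * A₁ := by
    refine hmono _ _ _ (hfin _ _ _ hz₂ hs) ?_
    filter_upwards [h₂', ae_restrict_mem hSm] with z hz hzS
    rw [hw z (hSd hzS), mul_comm, ENNReal.ofReal_mul
      (Real.rpow_nonneg (hw₂.pos z (hSd hzS)).le _), ← neg_sub p 1]
    gcongr
    exact hneg _ _ _ _ hz₂ ht₂ (hw₂.pos z (hSd hzS)) hs hz
  have e₂ : squareAverage (fun z => w z ^ (-(1 / (p - 1)))) I ℓ ≤
      (C₁ / A₁) ^ (1 / (p - 1)) * A₂ := by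
    refine hmono _ _ _ (hfin _ _ _ hz₁ (by positivity)) ?_
    filter_upwards [h₁', ae_restrict_mem hSm] with z hz hzS
    have hp₁ := hw₁.pos z (hSd hzS)
    have hp₂ := hw₂.pos z (hSd hzS)
    have : (1 - p) * -(1 / (p - 1)) = 1 := by field_simp; ring
    rw [hw z (hSd hzS), Real.mul_rpow hp₁.le (Real.rpow_nonneg hp₂.le _), ← Real.rpow_mul hp₂.le,
      this, Real.rpow_one, ENNReal.ofReal_mul (Real.rpow_nonneg hp₁.le _)]
    gcongr
    exact hneg _ _ _ _ hz₁ ht₁ hp₁ (by positivity) hz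
  calc _ ≤ (C₂ / A₂) ^ (p - 1) * A₁ * ((C₁ / A₁) ^ (1 / (p - 1)) * A₂) ^ (p - 1) := by gcongr
    _ = (C₁ / A₁ * A₁) * (C₂ / A₂ * A₂) ^ (p - 1) := by
        rw [ENNReal.mul_rpow_of_nonneg _ _ hs.le, ← ENNReal.rpow_mul, one_div_mul_cancel hs.ne',
          ENNReal.rpow_one, ENNReal.mul_rpow_of_nonneg _ _ hs.le]
        ring
    _ = C₁ * C₂ ^ (p - 1) := by
        rw [ENNReal.div_mul_cancel hz₁ ht₁, ENNReal.div_mul_cancel hz₂ ht₂]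

end BekolleBonami

end

theorem corollary3 (p : ℝ) (hp : 1 < p) (w : ℂ → ℝ) (hw : BekolleBonami.IsWeight w)
    (hosc : BekolleBonami.BoundedHyperbolicOscillation w) :
    BekolleBonami.MemBp p w ↔
      ∃ w₁ w₂ : ℂ → ℝ,
        (BekolleBonami.IsWeight w₁ ∧ BekolleBonami.MemB1 w₁ ∧
          BekolleBonami.BoundedHyperbolicOscillation w₁) ∧
        (BekolleBonami.IsWeight w₂ ∧ BekolleBonami.MemB1 w₂ ∧
          BekolleBonami.BoundedHyperbolicOscillation w₂) ∧
        ∀ z ∈ BekolleBonami.disc, w z = w₁ z * w₂ z ^ (1 - p) := by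
  constructor
  · exact BekolleBonami.exists_factorization_of_memBp hp hw hosc
  · rintro ⟨w₁, w₂, ⟨hw₁, h₁, -⟩, ⟨hw₂, h₂, -⟩, h⟩
    exact BekolleBonami.memBp_of_factorization hp hw₁ hw₂ h₁ h₂ h
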